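/- Let $q\in L^1_{loc}(\mathbb R)$ be real-valued and even, and assume that $\tau_q(y)=-y''-qy$ is in the limit circle case at $+\infty$ and at $-\infty$, i.e. for every $\lambda\in\mathbb C$ all solutions of $\tau_q(y)-\lambda y=0$ lie in $L^2((r,\infty))$ and in $L^2((-\infty,r))$ for some $r\in\mathbb R$. Let $\mathcal D_{\max}=\{y\in L^2(\mathbb R): y,y'\in AC_{loc}(\mathbb R),\ \tau_q y\in L^2(\mathbb R)\}$ and $A_{\max}y=\tau_q(y)$ for $y\in\mathcal D_{\max}$. Put $[f,g]_x=\overline{f(x)}g'(x)-\overline{f'(x)}g(x)$ and $[f,g]_{\pm\infty}=\lim_{x\to\pm\infty}[f,g]_x$. Let $w_1,w_2$ be real-valued solutions of $\tau_q(y)=0$, $w_1$ odd and $w_2$ even, with $[w_1,w_2]_{-\infty}=[w_1,w_2]_{\infty}=1$. For $f\in\mathcal D_{\max}$ put $\alpha_j(f)=[w_j,f]_{-\infty}$ and $\beta_j(f)=[w_j,f]_{\infty}$, $j=1,2$ (these limits exist). Let $(\mathcal Pf)(x)=f(-x)$ and $(\mathcal Tf)(x)=\overline{f(x)}$ on $L^2(\mathbb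 R)$. A closed densely defined operator $H$ in $L^2(\mathbb R)$ is called $\mathcal P\mathcal T$ symmetric if for all $f\in\operatorname{dom}H$ one has $\mathcal P\mathcal Tf\in\operatorname{dom}H$ and $\mathcal P\mathcal THf=H\mathcal P\mathcal Tf$; it is called $\mathcal P$-self-adjoint if $\operatorname{dom}H=\operatorname{dom}(H^*\mathcal P)$ and $Hf=\mathcal PH^*\mathcal Pf$ for all $f\in\operatorname{dom}H$. Let $a,b,c,d\in\mathbb C$ and let $\widetilde A$ be the restriction of $A_{\max}$ to one of the two domains given by mixed boundary conditions, $$\left\{f\in\mathcal D_{\max}:\begin{pmatrix}\alpha_1(f)\\ \alpha_2(f)\end{pmatrix}=\begin{bmatrix}a&b\\ c&d\end{bmatrix}\begin{pmatrix}\beta_1(f)\\ \beta_2(f)\end{pmatrix}\right\}\quad\text{or}\quad\left\{f\in\mathcal D_{\max}:\begin{pmatrix}\beta_1(f)\\ \beta_2(f)\end{pmatrix}=\begin{bmatrix}a&b\\ c&d\end{bmatrix}\begin{pmatrix}\alpha_1(f)\\ \alpha_2(f)\end{pmatrix}\right\}.$$ Then: (1) $\widetilde A$ is $\mathcal P\mathcal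 T$ symmetric, self-adjoint and $\mathcal P$-self-adjoint if and only if $a,b,c,d\in\mathbb R$, $a=d$ and $a^2-bc=1$. (2) $\widetilde A$ is self-adjoint and $\mathcal P$-self-adjoint if and only if $a,b,c,d\in\mathbb R$, $a=d$ and $a^2-bc=1$. In this case $\widetilde A$ is also $\mathcal P\mathcal T$ symmetric. (3) $\widetilde A$ is self-adjoint and $\mathcal P\mathcal T$ symmetric if and only if for some $\varphi\in\mathbb R$ the numbers $e^{-i\varphi}a,e^{-i\varphi}b,e^{-i\varphi}c,e^{-i\varphi}d$ are real, $d=e^{2i\varphi}\overline a$ and $ad-bc=e^{2i\varphi}$. (4) $\widetilde A$ is $\mathcal P$-self-adjoint and $\mathcal P\mathcal T$ symmetric if and only if $b,c\in\mathbb R$, $d=\overline a$ and $|a|^2-bc=1$. -/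

import Mathlib

open MeasureTheory Filter Topology
open scoped ComplexConjugate Matrix

noncomputable section

namespace PTQM

/-- The Hilbert space `L²(ℝ)` of complex-valued functions. -/
abbrev L2R : Type := Lp ℂ 2 (volume : Measure ℝ)

/-! ### The operators `P` and `T`, and the three classes of operators in `L²(ℝ)` -/

/-- Parity reflection, `(P f)(x) = f(-x)`. -/
def parity (f : L2R) : L2R :=
  Lp.compMeasurePreserving (fun x : ℝ => -x) (Measure.measurePreserving_neg volume) f

/-- Time reversal, `(T f)(x) = conj (f(x))`. -/
def timeReversal (f : L2R) : L2R := star f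

/-- The product `PT`. -/
def PT (f : L2R) : L2R := parity (timeReversal f)

theorem parity_ae (f : L2R) : ∀ᵐ x : ℝ, parity f x = f (-x) :=
  Lp.coeFn_compMeasurePreserving f (Measure.measurePreserving_neg volume)

theorem timeReversal_ae (f : L2R) : ∀ᵐ x : ℝ, timeReversal f x = conj (f x) :=
  Lp.coeFn_star f

/-- A closed densely defined operator `H` is `PT` symmetric if for all `f ∈ dom H` one has
`PT f ∈ dom H` and `PT H f = H PT f`. -/
def IsPTSymmetric (H : L2R →ₗ.[ℂ] L2R) : Prop :=
  H.IsClosed ∧ Dense (H.domain : Set L2R) ∧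
    ∀ f : H.domain, ∃ h : PT (f : L2R) ∈ H.domain, PT (H f) = H ⟨PT (f : L2R), h⟩

/-- A closed densely defined operator `H` is `P`-self-adjoint if `dom H = dom (H* P)` and
`H f = P H* P f` for all `f ∈ dom H`. -/
def IsPSelfAdjoint (H : L2R →ₗ.[ℂ] L2R) : Prop :=
  H.IsClosed ∧ Dense (H.domain : Set L2R) ∧
    (∀ f : L2R, f ∈ H.domain ↔ parity f ∈ H.adjoint.domain) ∧
    ∀ (f : L2R) (h : f ∈ H.domain) (h' : parity f ∈ H.adjoint.domain),
      H ⟨f, h⟩ = parity (H.adjoint ⟨parity f, h'⟩)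

/-! ### The differential expression -/

/-- `f` is absolutely continuous on every compact interval. -/
def ACLoc (f : ℝ → ℂ) : Prop := ∀ a b : ℝ, AbsolutelyContinuousOnInterval f a b

/-- `y` and `y'` are locally absolutely continuous (`y` is then differentiable everywhere, since
its derivative almost everywhere has a continuous representative). -/
structure IsRegular (y : ℝ → ℂ) : Prop where
  differentiable : Differentiable ℝ y
  ac : ACLoc y
  ac_deriv : ACLoc (deriv y)

/-- The differential expression `τ_q(y) = -y'' - q y`; the second derivative exists almost
everywhere when `y` is regular. -/
def tau (q : ℝ → ℝ) (y : ℝ → ℂ) (x : ℝ) : ℂ := -deriv (deriv y) x - (q x : ℂ) * y x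

/-- `y` is a solution of `τ_q(y) - l y = 0`. -/
def IsSolution (q : ℝ → ℝ) (l : ℂ) (y : ℝ → ℂ) : Prop :=
  IsRegular y ∧ ∀ᵐ x : ℝ, tau q y x - l * y x = 0

/-- Limit circle case at `+∞`. -/
def LimitCircleAtTop (q : ℝ → ℝ) : Prop :=
  ∀ (l : ℂ) (y : ℝ → ℂ), IsSolution q l y →
    ∃ a : ℝ, MemLp y 2 (volume.restrict (Set.Ioi a))

/-- Limit circle case at `-∞`. -/
def LimitCircleAtBot (q : ℝ → ℝ) : Prop :=
  ∀ (l : ℂ) (y : ℝ → ℂ), IsSolution q l y →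
    ∃ a : ℝ, MemLp y 2 (volume.restrict (Set.Iio a))

/-- The maximal domain `D_max`, as a set of functions. -/
structure InMaxDomain (q : ℝ → ℝ) (y : ℝ → ℂ) : Prop where
  memLp : MemLp y 2 volume
  regular : IsRegular y
  memLp_tau : MemLp (tau q y) 2 volume

theorem ACLoc.ae_differentiableAt {f : ℝ → ℂ} (hf : ACLoc f) :
    ∀ᵐ x : ℝ, DifferentiableAt ℝ f x := by
  have h : LocallyBoundedVariationOn f Set.univ := by
    intro a b _ _
    refine ((hf a b).boundedVariationOn).mono ?_
    exact Set.inter_subset_right.trans Set.Icc_subset_uIcc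
  exact h.ae_differentiableAt

theorem ACLoc.add {f g : ℝ → ℂ} (hf : ACLoc f) (hg : ACLoc g) : ACLoc (f + g) :=
  fun a b => (hf a b).add (hg a b)

theorem ACLoc.smul {f : ℝ → ℂ} (c : ℂ) (hf : ACLoc f) : ACLoc (c • f) :=
  fun a b => (hf a b).const_smul c

theorem IsRegular.deriv_add {y z : ℝ → ℂ} (hy : IsRegular y) (hz : IsRegular z) :
    deriv (y + z) = deriv y + deriv z := by
  funext x
  exact _root_.deriv_add (hy.differentiable x) (hz.differentiable x)

theorem IsRegular.deriv_smul {y : ℝ → ℂ} (c : ℂ) (hy : IsRegular y) :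
    deriv (c • y) = c • deriv y := by
  funext x
  exact deriv_const_smul c (hy.differentiable x)

theorem IsRegular.add {y z : ℝ → ℂ} (hy : IsRegular y) (hz : IsRegular z) :
    IsRegular (y + z) where
  differentiable := hy.differentiable.add hz.differentiable
  ac := hy.ac.add hz.ac
  ac_deriv := by
    rw [hy.deriv_add hz]
    exact hy.ac_deriv.add hz.ac_deriv

theorem IsRegular.smul {y : ℝ → ℂ} (c : ℂ) (hy : IsRegular y) : IsRegular (c • y) where
  differentiable := hy.differentiable.const_smul c
  ac := hy.ac.smul c
  ac_deriv := by
    rw [hy.deriv_smul c]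
    exact hy.ac_deriv.smul c

theorem tau_add_ae (q : ℝ → ℝ) {y z : ℝ → ℂ} (hy : IsRegular y) (hz : IsRegular z) :
    tau q (y + z) =ᵐ[volume] tau q y + tau q z := by
  filter_upwards [hy.ac_deriv.ae_differentiableAt, hz.ac_deriv.ae_differentiableAt] with x h1 h2
  simp only [tau, hy.deriv_add hz, Pi.add_apply, _root_.deriv_add h1 h2]
  ring

theorem tau_smul_ae (q : ℝ → ℝ) {y : ℝ → ℂ} (c : ℂ) (hy : IsRegular y) :
    tau q (c • y) =ᵐ[volume] c • tau q y := by
  filter_upwards [hy.ac_deriv.ae_differentiableAt] with x h1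
  simp only [tau, hy.deriv_smul c, Pi.smul_apply, deriv_const_smul c h1, smul_eq_mul]
  ring

theorem InMaxDomain.add {q : ℝ → ℝ} {y z : ℝ → ℂ} (hy : InMaxDomain q y)
    (hz : InMaxDomain q z) : InMaxDomain q (y + z) where
  memLp := hy.memLp.add hz.memLp
  regular := hy.regular.add hz.regular
  memLp_tau := (hy.memLp_tau.add hz.memLp_tau).ae_eq (tau_add_ae q hy.regular hz.regular).symm

theorem InMaxDomain.smul {q : ℝ → ℝ} {y : ℝ → ℂ} (c : ℂ) (hy : InMaxDomain q y) :
    InMaxDomain q (c • y) where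
  memLp := hy.memLp.const_smul c
  regular := hy.regular.smul c
  memLp_tau := (hy.memLp_tau.const_smul c).ae_eq (tau_smul_ae q c hy.regular).symm

theorem InMaxDomain.zero (q : ℝ → ℝ) : InMaxDomain q 0 := by
  have h : IsRegular (0 : ℝ → ℂ) := by
    have h0 : ACLoc (0 : ℝ → ℂ) := fun a b => by
      simpa [AbsolutelyContinuousOnInterval] using! tendsto_const_nhds
    have hd : deriv (0 : ℝ → ℂ) = 0 := by
      funext x
      exact deriv_const x (0 : ℂ)
    exact ⟨differentiable_const 0, h0, by rw [hd]; exact h0⟩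
  refine ⟨MemLp.zero, h, ?_⟩
  have ht : tau q 0 =ᵐ[volume] 0 := by
    have := tau_smul_ae q 0 h
    simpa using this
  exact MemLp.zero.ae_eq ht.symm

/-- A regular function is determined by its class in `L²(ℝ)`. -/
theorem IsRegular.eq_of_ae {y z : ℝ → ℂ} (hy : IsRegular y) (hz : IsRegular z)
    (h : y =ᵐ[volume] z) : y = z :=
  (Continuous.ae_eq_iff_eq volume hy.differentiable.continuous hz.differentiable.continuous).1 h

/-! ### The maximal operator -/

/-- The maximal domain `D_max`, as a subspace of `L²(ℝ)`. -/
def maxDomain (q : ℝ → ℝ) : Submodule ℂ L2R where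
  carrier := {f | ∃ y : ℝ → ℂ, InMaxDomain q y ∧ f =ᵐ[volume] y}
  zero_mem' := ⟨0, InMaxDomain.zero q, Lp.coeFn_zero _ _ _⟩
  add_mem' := by
    rintro f g ⟨y, hy, hfy⟩ ⟨z, hz, hgz⟩
    exact ⟨y + z, hy.add hz, (Lp.coeFn_add f g).trans (hfy.add hgz)⟩
  smul_mem' := by
    rintro c f ⟨y, hy, hfy⟩
    exact ⟨c • y, hy.smul c, (Lp.coeFn_smul c f).trans (hfy.const_smul c)⟩

/-- The unique locally absolutely continuous representative of an element of `D_max`. -/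
def rep {q : ℝ → ℝ} (f : maxDomain q) : ℝ → ℂ := f.2.choose

theorem rep_inMaxDomain {q : ℝ → ℝ} (f : maxDomain q) : InMaxDomain q (rep f) :=
  f.2.choose_spec.1

theorem coe_ae_eq_rep {q : ℝ → ℝ} (f : maxDomain q) : (f : L2R) =ᵐ[volume] rep f :=
  f.2.choose_spec.2

theorem rep_eq {q : ℝ → ℝ} (f : maxDomain q) {y : ℝ → ℂ} (hy : IsRegular y)
    (h : (f : L2R) =ᵐ[volume] y) : rep f = y :=
  (rep_inMaxDomain f).regular.eq_of_ae hy ((coe_ae_eq_rep f).symm.trans h)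

theorem rep_add {q : ℝ → ℝ} (f g : maxDomain q) : rep (f + g) = rep f + rep g :=
  rep_eq _ ((rep_inMaxDomain f).regular.add (rep_inMaxDomain g).regular)
    ((Lp.coeFn_add (f : L2R) (g : L2R)).trans ((coe_ae_eq_rep f).add (coe_ae_eq_rep g)))

theorem rep_smul {q : ℝ → ℝ} (c : ℂ) (f : maxDomain q) : rep (c • f) = c • rep f :=
  rep_eq _ ((rep_inMaxDomain f).regular.smul c)
    ((Lp.coeFn_smul c (f : L2R)).trans ((coe_ae_eq_rep f).const_smul c))

/-- The maximal operator: `A_max y = τ_q(y)` for `y ∈ D_max`. -/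
def maxOp (q : ℝ → ℝ) : L2R →ₗ.[ℂ] L2R where
  domain := maxDomain q
  toFun :=
    { toFun := fun f => (rep_inMaxDomain f).memLp_tau.toLp (tau q (rep f))
      map_add' := by
        intro f g
        rw [← MemLp.toLp_add]
        apply MemLp.toLp_congr
        rw [rep_add]
        exact tau_add_ae q (rep_inMaxDomain f).regular (rep_inMaxDomain g).regular
      map_smul' := by
        intro c f
        rw [RingHom.id_apply, ← MemLp.toLp_const_smul]
        apply MemLp.toLp_congr
        rw [rep_smul]
        exact tau_smul_ae q c (rep_inMaxDomain f).regular }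

/-! ### Boundary values and mixed boundary conditions -/

/-- `[f, g]_x = conj (f x) * g' x - conj (f' x) * g x`. -/
def bracket (f g : ℝ → ℂ) (x : ℝ) : ℂ := conj (f x) * deriv g x - conj (deriv f x) * g x

/-- Real-valued solutions `w₁` (odd) and `w₂` (even) of `τ_q(y) = 0` with
`[w₁, w₂]_{-∞} = [w₁, w₂]_{∞} = 1`. (The brackets `[w₁, w₁]` and `[w₂, w₂]` vanish identically,
because `w₁` and `w₂` are real-valued.) -/
structure IsBoundarySystem (q : ℝ → ℝ) (w₁ w₂ : ℝ → ℂ) : Prop where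
  sol₁ : IsSolution q 0 w₁
  sol₂ : IsSolution q 0 w₂
  real₁ : ∀ x, (w₁ x).im = 0
  real₂ : ∀ x, (w₂ x).im = 0
  odd₁ : Function.Odd w₁
  even₂ : Function.Even w₂
  bracket_bot : Tendsto (bracket w₁ w₂) atBot (𝓝 1)
  bracket_top : Tendsto (bracket w₁ w₂) atTop (𝓝 1)

/-- `α = (α₁(y), α₂(y))` and `β = (β₁(y), β₂(y))`, that is `α_j = [w_j, y]_{-∞}` and
`β_j = [w_j, y]_{∞}` (all four limits exist). -/
structure HasBoundaryValues (w₁ w₂ y : ℝ → ℂ) (α β : Fin 2 → ℂ) : Prop where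
  alpha₁ : Tendsto (bracket w₁ y) atBot (𝓝 (α 0))
  alpha₂ : Tendsto (bracket w₂ y) atBot (𝓝 (α 1))
  beta₁ : Tendsto (bracket w₁ y) atTop (𝓝 (β 0))
  beta₂ : Tendsto (bracket w₂ y) atTop (𝓝 (β 1))

theorem bracket_add (w : ℝ → ℂ) {y z : ℝ → ℂ} (hy : IsRegular y) (hz : IsRegular z) :
    bracket w (y + z) = bracket w y + bracket w z := by
  funext x
  simp only [bracket, hy.deriv_add hz, Pi.add_apply]
  ring

theorem bracket_smul (w : ℝ → ℂ) {y : ℝ → ℂ} (c : ℂ) (hy : IsRegular y) :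
    bracket w (c • y) = c • bracket w y := by
  funext x
  simp only [bracket, hy.deriv_smul c, Pi.smul_apply, smul_eq_mul]
  ring

theorem HasBoundaryValues.add {w₁ w₂ y z : ℝ → ℂ} {α β α' β' : Fin 2 → ℂ}
    (hy : IsRegular y) (hz : IsRegular z) (h : HasBoundaryValues w₁ w₂ y α β)
    (h' : HasBoundaryValues w₁ w₂ z α' β') :
    HasBoundaryValues w₁ w₂ (y + z) (α + α') (β + β') := by
  constructor <;> rw [bracket_add _ hy hz]
  exacts [h.alpha₁.add h'.alpha₁, h.alpha₂.add h'.alpha₂, h.beta₁.add h'.beta₁,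
    h.beta₂.add h'.beta₂]

theorem HasBoundaryValues.smul {w₁ w₂ y : ℝ → ℂ} {α β : Fin 2 → ℂ} (c : ℂ)
    (hy : IsRegular y) (h : HasBoundaryValues w₁ w₂ y α β) :
    HasBoundaryValues w₁ w₂ (c • y) (c • α) (c • β) := by
  constructor <;> rw [bracket_smul _ c hy]
  exacts [h.alpha₁.const_smul c, h.alpha₂.const_smul c, h.beta₁.const_smul c,
    h.beta₂.const_smul c]

theorem HasBoundaryValues.zero (w₁ w₂ : ℝ → ℂ) : HasBoundaryValues w₁ w₂ 0 0 0 := by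
  have h : ∀ w : ℝ → ℂ, bracket w 0 = fun _ => 0 := by
    intro w
    simpa using! bracket_smul w 0 (InMaxDomain.zero 0).regular
  constructor <;> rw [h] <;> exact tendsto_const_nhds

/-- The functions in `D_max` whose boundary values `(α, β)` lie in the subspace `S`. -/
def boundaryDomain (q : ℝ → ℝ) (w₁ w₂ : ℝ → ℂ)
    (S : Submodule ℂ ((Fin 2 → ℂ) × (Fin 2 → ℂ))) : Submodule ℂ L2R where
  carrier := {f | ∃ y : ℝ → ℂ, InMaxDomain q y ∧ f =ᵐ[volume] y ∧
    ∃ α β : Fin 2 → ℂ, HasBoundaryValues w₁ w₂ y α β ∧ (α, β) ∈ S}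
  zero_mem' := ⟨0, InMaxDomain.zero q, Lp.coeFn_zero _ _ _, 0, 0,
    HasBoundaryValues.zero w₁ w₂, S.zero_mem⟩
  add_mem' := by
    rintro f g ⟨y, hy, hfy, α, β, h, hS⟩ ⟨z, hz, hgz, α', β', h', hS'⟩
    exact ⟨y + z, hy.add hz, (Lp.coeFn_add f g).trans (hfy.add hgz), α + α', β + β',
      h.add hy.regular hz.regular h', S.add_mem hS hS'⟩
  smul_mem' := by
    rintro c f ⟨y, hy, hfy, α, β, h, hS⟩
    exact ⟨c • y, hy.smul c, (Lp.coeFn_smul c f).trans (hfy.const_smul c), c • α, c • β,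
      h.smul c hy.regular, S.smul_mem c hS⟩

/-- The pairs `(α, β)` with `α = M β`. -/
def mixedRel₁ (M : Matrix (Fin 2) (Fin 2) ℂ) : Submodule ℂ ((Fin 2 → ℂ) × (Fin 2 → ℂ)) where
  carrier := {p | p.1 = M *ᵥ p.2}
  zero_mem' := (Matrix.mulVec_zero M).symm
  add_mem' := by
    intro p p' (h : p.1 = M *ᵥ p.2) (h' : p'.1 = M *ᵥ p'.2)
    change p.1 + p'.1 = M *ᵥ (p.2 + p'.2)
    rw [Matrix.mulVec_add, h, h']
  smul_mem' := by
    intro c p (h : p.1 = M *ᵥ p.2)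
    change c • p.1 = M *ᵥ (c • p.2)
    rw [Matrix.mulVec_smul, h]

/-- The pairs `(α, β)` with `β = M α`. -/
def mixedRel₂ (M : Matrix (Fin 2) (Fin 2) ℂ) : Submodule ℂ ((Fin 2 → ℂ) × (Fin 2 → ℂ)) where
  carrier := {p | p.2 = M *ᵥ p.1}
  zero_mem' := (Matrix.mulVec_zero M).symm
  add_mem' := by
    intro p p' (h : p.2 = M *ᵥ p.1) (h' : p'.2 = M *ᵥ p'.1)
    change p.2 + p'.2 = M *ᵥ (p.1 + p'.1)
    rw [Matrix.mulVec_add, h, h']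
  smul_mem' := by
    intro c p (h : p.2 = M *ᵥ p.1)
    change c • p.2 = M *ᵥ (c • p.1)
    rw [Matrix.mulVec_smul, h]

/-- The restriction of the maximal operator to the functions that satisfy the mixed boundary
condition `(α₁(f), α₂(f))ᵀ = M (β₁(f), β₂(f))ᵀ`. -/
def mixedOp₁ (q : ℝ → ℝ) (w₁ w₂ : ℝ → ℂ) (M : Matrix (Fin 2) (Fin 2) ℂ) : L2R →ₗ.[ℂ] L2R :=
  (maxOp q).domRestrict (boundaryDomain q w₁ w₂ (mixedRel₁ M))

/-- The restriction of the maximal operator to the functions that satisfy the mixed boundary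
condition `(β₁(f), β₂(f))ᵀ = M (α₁(f), α₂(f))ᵀ`. -/
def mixedOp₂ (q : ℝ → ℝ) (w₁ w₂ : ℝ → ℂ) (M : Matrix (Fin 2) (Fin 2) ℂ) : L2R →ₗ.[ℂ] L2R :=
  (maxOp q).domRestrict (boundaryDomain q w₁ w₂ (mixedRel₂ M))

end PTQM

end

/-!
Green's formula gives `⟪A_max f, g⟫ - ⟪f, A_max g⟫ = [f, g]_∞ - [f, g]_{-∞}`. As `[w₁, w₂] = 1`,
the Plücker relation for `2 × 2` minors writes `[f, g]` through the brackets of `f` and `g` with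
`w₁, w₂`, so the right-hand side is the boundary form `symp β β' - symp α α'`, where
`symp u v = conj u₁ v₂ - conj u₂ v₁`. Variation of constants, together with Green's formula against
the two solutions of `τ_q(y) = 0`, shows that the pair `(α, β)` takes every value in `ℂ² × ℂ²` and
that the adjoint of the restriction of `A_max` to `(α, β) ∈ S` is its restriction to the orthogonal
complement of `S` for the boundary form. On boundary values `P` exchanges the endpoints and changes
the sign of the second component, and `T` is complex conjugation. The three symmetries of the
operator with boundary matrix `M` thus become, with `R = diag(1, -1)` and `M†` the adjoint of `M`
for `symp`, the equations `M† M = 1`, `M = R M† R` and `R (conj M) R M = 1`. The phase in (3) comes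
from `det M`: the first equation says that `M = (det M) conj M` with `|det M| = 1`.
-/

noncomputable section

namespace PTQM

/-! ### Locally absolutely continuous functions -/

theorem absolutelyContinuousOnInterval_of_dist_le {X Y : Type*} [PseudoMetricSpace X]
    [PseudoMetricSpace Y] {f : ℝ → X} {g : ℝ → Y} {a b : ℝ}
    (hf : AbsolutelyContinuousOnInterval f a b)
    (h : ∀ x y, dist (g x) (g y) ≤ dist (f x) (f y)) :
    AbsolutelyContinuousOnInterval g a b := by
  rw [absolutelyContinuousOnInterval_iff] at hf ⊢
  intro ε hε
  obtain ⟨δ, hδ, H⟩ := hf ε hε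
  exact ⟨δ, hδ, fun E hE hs => (Finset.sum_le_sum fun i _ => h _ _).trans_lt (H E hE hs)⟩

theorem neg_swap_mem_disjWithin {a b : ℝ} {E : ℕ × (ℕ → ℝ × ℝ)}
    (hE : E ∈ AbsolutelyContinuousOnInterval.disjWithin a b) :
    (E.1, fun i => (-(E.2 i).2, -(E.2 i).1)) ∈
      AbsolutelyContinuousOnInterval.disjWithin (-a) (-b) := by
  obtain ⟨hmem, hdisj⟩ := hE
  refine ⟨fun i hi => ?_, fun i hi j hj hij => ?_⟩
  · obtain ⟨h₁, h₂⟩ := hmem i hi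
    rw [Set.mem_uIcc] at h₁ h₂
    simp only [Set.mem_uIcc, neg_le_neg_iff]
    exact ⟨by tauto, by tauto⟩
  · have h := hdisj hi hj hij
    simp only [Function.onFun, Set.uIoc, Set.Ioc_disjoint_Ioc] at h ⊢
    simp only [min_neg_neg, max_neg_neg]
    rw [min_comm (E.2 i).2, max_comm (E.2 i).2, min_comm (E.2 j).2, max_comm (E.2 j).2]
    linarith

theorem absolutelyContinuousOnInterval_comp_neg {X : Type*} [PseudoMetricSpace X] {f : ℝ → X}
    {a b : ℝ} (hf : AbsolutelyContinuousOnInterval f (-a) (-b)) :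
    AbsolutelyContinuousOnInterval (fun x => f (-x)) a b := by
  rw [absolutelyContinuousOnInterval_iff] at hf ⊢
  intro ε hε
  obtain ⟨δ, hδ, H⟩ := hf ε hε
  refine ⟨δ, hδ, fun E hE hs => ?_⟩
  have := H _ (neg_swap_mem_disjWithin hE) (by simpa [dist_comm] using hs)
  simpa [dist_comm] using this

theorem absolutelyContinuousOnInterval_integral {E : Type*} [NormedAddCommGroup E]
    [NormedSpace ℝ E] {h : ℝ → E} (hh : LocallyIntegrable h volume) (c a b : ℝ) :
    AbsolutelyContinuousOnInterval (fun x => ∫ t in c..x, h t) a b := by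
  have hi : ∀ a b, IntervalIntegrable h volume a b := fun a b =>
    (hh.integrableOn_isCompact isCompact_uIcc).intervalIntegrable
  have hnorm : AbsolutelyContinuousOnInterval (fun x => ∫ t in a..x, ‖h t‖) a b :=
    (hi a b).norm.absolutelyContinuousOnInterval_intervalIntegral Set.left_mem_uIcc
  refine absolutelyContinuousOnInterval_of_dist_le hnorm fun x y => ?_
  rw [dist_eq_norm, dist_eq_norm, intervalIntegral.integral_interval_sub_left (hi _ _) (hi _ _),
    intervalIntegral.integral_interval_sub_left (hi _ _).norm (hi _ _).norm]
  exact intervalIntegral.norm_integral_le_abs_integral_norm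

theorem ACLoc.mul {f g : ℝ → ℂ} (hf : ACLoc f) (hg : ACLoc g) : ACLoc (fun x => f x * g x) :=
  fun a b => (hf a b).fun_smul (hg a b)

theorem ACLoc.sub {f g : ℝ → ℂ} (hf : ACLoc f) (hg : ACLoc g) : ACLoc (fun x => f x - g x) :=
  fun a b => (hf a b).fun_sub (hg a b)

theorem ACLoc.conj {f : ℝ → ℂ} (hf : ACLoc f) : ACLoc (fun x => conj (f x)) :=
  fun a b => absolutelyContinuousOnInterval_of_dist_le (hf a b) fun x y =>
    (Complex.dist_conj_conj (f x) (f y)).le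

theorem ACLoc.comp_neg {f : ℝ → ℂ} (hf : ACLoc f) : ACLoc (fun x => f (-x)) :=
  fun a b => absolutelyContinuousOnInterval_comp_neg (hf (-a) (-b))

theorem ACLoc.continuous {f : ℝ → ℂ} (hf : ACLoc f) : Continuous f := by
  rw [continuous_iff_continuousAt]
  intro x
  refine (hf (x - 1) (x + 1)).continuousOn.continuousAt ?_
  rw [Set.uIcc_of_le (by linarith)]
  exact Icc_mem_nhds (by linarith) (by linarith)

theorem acLoc_integral {h : ℝ → ℂ} (hh : LocallyIntegrable h volume) :
    ACLoc (fun x => ∫ t in (0 : ℝ)..x, h t) :=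
  absolutelyContinuousOnInterval_integral hh 0

theorem ACLoc.integral_eq_sub {f h : ℝ → ℂ} (hf : ACLoc f) (hh : LocallyIntegrable h volume)
    (hd : ∀ᵐ x, HasDerivAt f (h x) x) (a b : ℝ) : ∫ t in a..b, h t = f b - f a := by
  have hi : ∀ a b, IntervalIntegrable h volume a b := fun a b =>
    (hh.integrableOn_isCompact isCompact_uIcc).intervalIntegrable
  have hzero : ∀ᵐ x, x ∈ Set.uIcc a b →
      HasDerivAt (fun x => f x - ∫ t in (0 : ℝ)..x, h t) 0 x := by
    filter_upwards [hd, LocallyIntegrable.ae_hasDerivAt_integral hh] with x hfx hhx _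
    simpa using hfx.fun_sub (hhx 0)
  obtain ⟨C, hC⟩ := (hf.sub (acLoc_integral hh) a b).const_of_ae_hasDerivAt_zero hzero
  have ha := hC a Set.left_mem_uIcc
  have hb := hC b Set.right_mem_uIcc
  rw [← intervalIntegral.integral_interval_sub_left (hi 0 b) (hi 0 a)]
  linear_combination ha - hb

theorem IsRegular.hasDerivAt {y : ℝ → ℂ} (hy : IsRegular y) (x : ℝ) :
    HasDerivAt y (deriv y x) x := (hy.differentiable x).hasDerivAt

theorem IsRegular.ae_hasDerivAt_deriv {y : ℝ → ℂ} (hy : IsRegular y) :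
    ∀ᵐ x, HasDerivAt (deriv y) (deriv (deriv y) x) x := by
  filter_upwards [hy.ac_deriv.ae_differentiableAt] with x hx using hx.hasDerivAt

theorem ACLoc.hasDerivAt_of_ae_hasDerivAt {y z : ℝ → ℂ} (hy : ACLoc y) (hz : Continuous z)
    (h : ∀ᵐ x, HasDerivAt y (z x) x) (x : ℝ) : HasDerivAt y (z x) x := by
  have hprim : y = fun x => y 0 + ∫ t in (0 : ℝ)..x, z t := by
    funext x
    rw [hy.integral_eq_sub hz.locallyIntegrable h, add_sub_cancel]
  rw [hprim]
  exact (intervalIntegral.integral_hasDerivAt_right (hz.intervalIntegrable _ _)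
    (hz.stronglyMeasurableAtFilter _ _) hz.continuousAt).const_add _

theorem IsRegular.of_hasDerivAt {y z : ℝ → ℂ} (hy : ACLoc y) (hz : ACLoc z)
    (h : ∀ x, HasDerivAt y (z x) x) : IsRegular y where
  differentiable x := (h x).differentiableAt
  ac := hy
  ac_deriv := by rwa [show deriv y = z from funext fun x => (h x).deriv]

/-! ### Reflection and complex conjugation -/

theorem IsRegular.comp_neg {y : ℝ → ℂ} (hy : IsRegular y) : IsRegular (fun x => y (-x)) := by
  refine .of_hasDerivAt (z := fun x => (-1 : ℂ) * deriv y (-x)) hy.ac.comp_neg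
    (hy.ac_deriv.comp_neg.smul (-1)) fun x => ?_
  simpa [Function.comp_def] using (hy.hasDerivAt (-x)).scomp x (hasDerivAt_neg x)

theorem tau_comp_neg {q : ℝ → ℝ} (hq : Function.Even q) (y : ℝ → ℂ) :
    tau q (fun x => y (-x)) = fun x => tau q y (-x) := by
  have hderiv : deriv (fun x => y (-x)) = fun x => -deriv y (-x) :=
    funext fun x => deriv_comp_neg y x
  funext x
  rw [tau, tau, hderiv, deriv.fun_neg, deriv_comp_neg (deriv y), hq, neg_neg]

theorem InMaxDomain.comp_neg {q : ℝ → ℝ} (hq : Function.Even q) {y : ℝ → ℂ}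
    (hy : InMaxDomain q y) : InMaxDomain q (fun x => y (-x)) where
  memLp := hy.memLp.comp_measurePreserving (Measure.measurePreserving_neg volume)
  regular := hy.regular.comp_neg
  memLp_tau := by
    rw [tau_comp_neg hq]
    exact hy.memLp_tau.comp_measurePreserving (Measure.measurePreserving_neg volume)

theorem deriv_conj (y : ℝ → ℂ) : deriv (fun x => conj (y x)) = fun x => conj (deriv y x) :=
  deriv.star'

theorem IsRegular.conj {y : ℝ → ℂ} (hy : IsRegular y) : IsRegular (fun x => conj (y x)) where
  differentiable := hy.differentiable.star
  ac := hy.ac.conj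
  ac_deriv := by
    rw [deriv_conj]
    exact hy.ac_deriv.conj

theorem tau_conj (q : ℝ → ℝ) (y : ℝ → ℂ) :
    tau q (fun x => conj (y x)) = fun x => conj (tau q y x) := by
  funext x
  simp only [tau, deriv_conj, map_sub, map_neg, map_mul, Complex.conj_ofReal]

theorem InMaxDomain.conj {q : ℝ → ℝ} {y : ℝ → ℂ} (hy : InMaxDomain q y) :
    InMaxDomain q (fun x => conj (y x)) where
  memLp := hy.memLp.star
  regular := hy.regular.conj
  memLp_tau := by
    rw [tau_conj]
    exact hy.memLp_tau.star

/-! ### The bracket and Green's formula -/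

theorem acLoc_bracket {f g : ℝ → ℂ} (hf : IsRegular f) (hg : IsRegular g) :
    ACLoc (bracket f g) :=
  (hf.ac.conj.mul hg.ac_deriv).sub (hf.ac_deriv.conj.mul hg.ac)

theorem ae_hasDerivAt_bracket (q : ℝ → ℝ) {f g : ℝ → ℂ} (hf : IsRegular f) (hg : IsRegular g) :
    ∀ᵐ x, HasDerivAt (bracket f g) (conj (tau q f x) * g x - conj (f x) * tau q g x) x := by
  filter_upwards [hf.ae_hasDerivAt_deriv, hg.ae_hasDerivAt_deriv] with x hf' hg'
  have h : HasDerivAt (bracket f g) _ x :=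
    ((hf.hasDerivAt x).star.mul hg').sub (hf'.star.mul (hg.hasDerivAt x))
  refine h.congr_deriv ?_
  simp only [tau, map_sub, map_neg, map_mul, Complex.conj_ofReal, ← starRingEnd_apply]
  ring

theorem IsSolution.bracket_eq {q : ℝ → ℝ} {l : ℂ} {f g : ℝ → ℂ} (hf : IsSolution q (conj l) f)
    (hg : IsSolution q l g) (x x' : ℝ) : bracket f g x = bracket f g x' := by
  have hderiv : ∀ᵐ x, HasDerivAt (bracket f g) 0 x := by
    filter_upwards [ae_hasDerivAt_bracket q hf.1 hg.1, hf.2, hg.2] with x h hfx hgx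
    refine h.congr_deriv ?_
    rw [sub_eq_zero.1 hfx, sub_eq_zero.1 hgx, map_mul, Complex.conj_conj]
    ring
  have h := (acLoc_bracket hf.1 hg.1).integral_eq_sub continuous_const.locallyIntegrable hderiv
    x' x
  rw [intervalIntegral.integral_zero] at h
  exact sub_eq_zero.1 h.symm

namespace InMaxDomain

variable {q : ℝ → ℝ} {f g : ℝ → ℂ}

theorem integrable_conj_tau_mul (hf : InMaxDomain q f) (hg : InMaxDomain q g) :
    Integrable (fun x => conj (tau q f x) * g x) volume :=
  hf.memLp_tau.star.integrable_mul hg.memLp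

theorem integrable_conj_mul_tau (hf : InMaxDomain q f) (hg : InMaxDomain q g) :
    Integrable (fun x => conj (f x) * tau q g x) volume :=
  hf.memLp.star.integrable_mul hg.memLp_tau

theorem integrable_green (hf : InMaxDomain q f) (hg : InMaxDomain q g) :
    Integrable (fun x => conj (tau q f x) * g x - conj (f x) * tau q g x) volume :=
  (hf.integrable_conj_tau_mul hg).sub (hf.integrable_conj_mul_tau hg)

theorem intervalIntegral_green (hf : InMaxDomain q f) (hg : InMaxDomain q g) (a b : ℝ) :
    ∫ x in a..b, (conj (tau q f x) * g x - conj (f x) * tau q g x) =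
      bracket f g b - bracket f g a :=
  (acLoc_bracket hf.regular hg.regular).integral_eq_sub
    (hf.integrable_green hg).locallyIntegrable (ae_hasDerivAt_bracket q hf.regular hg.regular) a b

theorem exists_tendsto_bracket_atTop (hf : InMaxDomain q f) (hg : InMaxDomain q g) :
    ∃ v : ℂ, Tendsto (bracket f g) atTop (𝓝 v) := by
  have h := intervalIntegral_tendsto_integral_Ioi 0 (hf.integrable_green hg).integrableOn
    tendsto_id
  simp only [hf.intervalIntegral_green hg, id] at h
  exact ⟨_, (h.add_const (bracket f g 0)).congr fun x => sub_add_cancel _ _⟩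

theorem exists_tendsto_bracket_atBot (hf : InMaxDomain q f) (hg : InMaxDomain q g) :
    ∃ u : ℂ, Tendsto (bracket f g) atBot (𝓝 u) := by
  have h := intervalIntegral_tendsto_integral_Iic 0 (hf.integrable_green hg).integrableOn
    tendsto_id
  simp only [hf.intervalIntegral_green hg, id] at h
  exact ⟨_, (h.const_sub (bracket f g 0)).congr fun x => sub_sub_cancel _ _⟩

theorem integral_green (hf : InMaxDomain q f) (hg : InMaxDomain q g) {u v : ℂ}
    (hu : Tendsto (bracket f g) atBot (𝓝 u)) (hv : Tendsto (bracket f g) atTop (𝓝 v)) :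
    ∫ x, (conj (tau q f x) * g x - conj (f x) * tau q g x) = v - u := by
  have h := intervalIntegral_tendsto_integral (hf.integrable_green hg) tendsto_neg_atTop_atBot
    tendsto_id
  simp only [hf.intervalIntegral_green hg] at h
  exact tendsto_nhds_unique h (hv.sub (hu.comp tendsto_neg_atTop_atBot))

end InMaxDomain

theorem bracket_of_real {w : ℝ → ℂ} (hw : ∀ x, (w x).im = 0) (y : ℝ → ℂ) (x : ℝ) :
    bracket w y x = w x * deriv y x - deriv w x * y x := by
  have hconj : (fun x => conj (w x)) = w := funext fun x => Complex.conj_eq_iff_im.2 (hw x)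
  rw [bracket, ← congrFun (deriv_conj w) x, hconj, Complex.conj_eq_iff_im.2 (hw x)]

theorem bracket_conj_of_real {w : ℝ → ℂ} (hw : ∀ x, (w x).im = 0) (y : ℝ → ℂ) :
    bracket w (fun x => conj (y x)) = fun x => conj (bracket w y x) := by
  funext x
  rw [bracket_of_real hw, deriv_conj, bracket, map_sub, map_mul, map_mul, Complex.conj_conj,
    Complex.conj_conj]

theorem bracket_comp_neg_of_odd {w : ℝ → ℂ} (hw : Function.Odd w) (y : ℝ → ℂ) :
    bracket w (fun x => y (-x)) = fun x => bracket w y (-x) := by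
  funext x
  have hderiv : deriv w x = deriv w (-x) := by
    have h := deriv_comp_neg w x
    rw [funext hw, deriv.fun_neg] at h
    exact neg_injective h
  rw [bracket, bracket, deriv_comp_neg, hderiv, hw x, map_neg]
  ring

theorem bracket_comp_neg_of_even {w : ℝ → ℂ} (hw : Function.Even w) (y : ℝ → ℂ) :
    bracket w (fun x => y (-x)) = fun x => -bracket w y (-x) := by
  funext x
  have hderiv : deriv w x = -deriv w (-x) := by
    have h := deriv_comp_neg w x
    rwa [funext hw] at h
  rw [bracket, bracket, deriv_comp_neg, hderiv, hw x, map_neg]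
  ring

/-! ### Boundary values -/

theorem HasBoundaryValues.unique {w₁ w₂ y : ℝ → ℂ} {α β α' β' : Fin 2 → ℂ}
    (h : HasBoundaryValues w₁ w₂ y α β) (h' : HasBoundaryValues w₁ w₂ y α' β') :
    α = α' ∧ β = β' := by
  constructor <;> funext i <;> fin_cases i
  exacts [tendsto_nhds_unique h.alpha₁ h'.alpha₁, tendsto_nhds_unique h.alpha₂ h'.alpha₂,
    tendsto_nhds_unique h.beta₁ h'.beta₁, tendsto_nhds_unique h.beta₂ h'.beta₂]

theorem InMaxDomain.exists_hasBoundaryValues {q : ℝ → ℝ} {w₁ w₂ y : ℝ → ℂ}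
    (h₁ : InMaxDomain q w₁) (h₂ : InMaxDomain q w₂) (hy : InMaxDomain q y) :
    ∃ α β, HasBoundaryValues w₁ w₂ y α β := by
  obtain ⟨u₁, hu₁⟩ := h₁.exists_tendsto_bracket_atBot hy
  obtain ⟨u₂, hu₂⟩ := h₂.exists_tendsto_bracket_atBot hy
  obtain ⟨v₁, hv₁⟩ := h₁.exists_tendsto_bracket_atTop hy
  obtain ⟨v₂, hv₂⟩ := h₂.exists_tendsto_bracket_atTop hy
  exact ⟨![u₁, u₂], ![v₁, v₂], hu₁, hu₂, hv₁, hv₂⟩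

theorem HasBoundaryValues.conj {w₁ w₂ y : ℝ → ℂ} (h₁ : ∀ x, (w₁ x).im = 0)
    (h₂ : ∀ x, (w₂ x).im = 0) {α β : Fin 2 → ℂ} (h : HasBoundaryValues w₁ w₂ y α β) :
    HasBoundaryValues w₁ w₂ (fun x => conj (y x)) (star α) (star β) := by
  constructor <;> simp only [bracket_conj_of_real h₁, bracket_conj_of_real h₂]
  exacts [h.alpha₁.star, h.alpha₂.star, h.beta₁.star, h.beta₂.star]

/-- The matrix by which the reflection `x ↦ -x` acts on boundary values, apart from exchanging the
two endpoints. -/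
def reflection : Matrix (Fin 2) (Fin 2) ℂ := !![1, 0; 0, -1]

theorem reflection_mul_self : reflection * reflection = 1 := by
  simp [reflection, Matrix.one_fin_two]

theorem HasBoundaryValues.comp_neg {w₁ w₂ y : ℝ → ℂ} (h₁ : Function.Odd w₁)
    (h₂ : Function.Even w₂) {α β : Fin 2 → ℂ} (h : HasBoundaryValues w₁ w₂ y α β) :
    HasBoundaryValues w₁ w₂ (fun x => y (-x)) (reflection *ᵥ β) (reflection *ᵥ α) := by
  have hrefl : ∀ v : Fin 2 → ℂ, reflection *ᵥ v = ![v 0, -v 1] := fun v => by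
    funext i; fin_cases i <;> simp [reflection, Matrix.mulVec, dotProduct]
  rw [hrefl, hrefl]
  constructor <;> simp only [bracket_comp_neg_of_odd h₁, bracket_comp_neg_of_even h₂]
  exacts [h.beta₁.comp tendsto_neg_atBot_atTop, (h.beta₂.comp tendsto_neg_atBot_atTop).neg,
    h.alpha₁.comp tendsto_neg_atTop_atBot, (h.alpha₂.comp tendsto_neg_atTop_atBot).neg]

theorem IsSolution.memLp {q : ℝ → ℝ} {l : ℂ} {y : ℝ → ℂ} (hy : IsSolution q l y)
    (hq_top : LimitCircleAtTop q) (hq_bot : LimitCircleAtBot q) : MemLp y 2 volume := by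
  have hcont : Continuous y := hy.1.ac.continuous
  obtain ⟨a, ha⟩ := hq_top l y hy
  obtain ⟨b, hb⟩ := hq_bot l y hy
  rw [memLp_two_iff_integrable_sq_norm hcont.aestronglyMeasurable] at ha hb ⊢
  exact integrable_iff_integrableAtFilter_atBot_atTop.2
    ⟨⟨⟨Set.Iio b, Iio_mem_atBot b, hb⟩, ⟨Set.Ioi a, Ioi_mem_atTop a, ha⟩⟩,
      (hcont.norm.pow 2).locallyIntegrable⟩

/-- Two real-valued square integrable solutions of `τ_q(y) = 0` with Wronskian `1`; in the limit
circle case they are the reference functions with respect to which boundary values are taken. -/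
structure IsFundamentalPair (q : ℝ → ℝ) (w₁ w₂ : ℝ → ℂ) : Prop where
  mem₁ : InMaxDomain q w₁
  mem₂ : InMaxDomain q w₂
  tau₁ : tau q w₁ =ᵐ[volume] 0
  tau₂ : tau q w₂ =ᵐ[volume] 0
  real₁ : ∀ x, (w₁ x).im = 0
  real₂ : ∀ x, (w₂ x).im = 0
  bracket_eq_one : ∀ x, bracket w₁ w₂ x = 1

theorem IsBoundarySystem.isFundamentalPair {q : ℝ → ℝ} {w₁ w₂ : ℝ → ℂ}
    (hw : IsBoundarySystem q w₁ w₂) (hq_top : LimitCircleAtTop q) (hq_bot : LimitCircleAtBot q) :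
    IsFundamentalPair q w₁ w₂ := by
  have htau : ∀ {w}, IsSolution q 0 w → tau q w =ᵐ[volume] 0 := fun h => by
    filter_upwards [h.2] with x hx
    simpa using hx
  have hmem : ∀ {w}, IsSolution q 0 w → InMaxDomain q w := fun h =>
    ⟨h.memLp hq_top hq_bot, h.1, MemLp.zero.ae_eq (htau h).symm⟩
  refine ⟨hmem hw.sol₁, hmem hw.sol₂, htau hw.sol₁, htau hw.sol₂, hw.real₁, hw.real₂, fun x => ?_⟩
  have hconst : bracket w₁ w₂ = fun _ => bracket w₁ w₂ x := funext fun x' =>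
    IsSolution.bracket_eq (l := 0) (by rw [map_zero]; exact hw.sol₁) hw.sol₂ x' x
  have hlim := hw.bracket_top
  rw [hconst] at hlim
  exact tendsto_nhds_unique tendsto_const_nhds hlim

/-- The standard skew-Hermitian form on `ℂ²`, conjugate-linear in the first argument. -/
def symp : (Fin 2 → ℂ) →ₗ⋆[ℂ] (Fin 2 → ℂ) →ₗ[ℂ] ℂ :=
  Matrix.toLinearMapₛₗ₂' ℂ (starRingEnd ℂ) (RingHom.id ℂ) !![0, 1; -1, 0]

theorem symp_apply (u v : Fin 2 → ℂ) : symp u v = conj (u 0) * v 1 - conj (u 1) * v 0 := by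
  simp [symp, Matrix.toLinearMapₛₗ₂'_apply, Fin.sum_univ_two, sub_eq_add_neg]

theorem symp_ext {v v' : Fin 2 → ℂ}
    (h : ∀ i, symp (Pi.single i 1) v = symp (Pi.single i 1) v') : v = v' := by
  have h₀ : v 1 = v' 1 := by simpa [symp_apply] using h 0
  have h₁ : v 0 = v' 0 := by simpa [symp_apply] using h 1
  funext i
  fin_cases i
  exacts [h₁, h₀]

/-- The space of pairs `(α, β)` of boundary values at `-∞` and `+∞`. -/
abbrev BoundarySpace : Type := (Fin 2 → ℂ) × (Fin 2 → ℂ)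

/-- The boundary form of Green's formula: the contribution of `+∞` minus that of `-∞`. -/
def boundaryForm : BoundarySpace →ₗ⋆[ℂ] BoundarySpace →ₗ[ℂ] ℂ :=
  (symp.comp (LinearMap.snd ℂ (Fin 2 → ℂ) (Fin 2 → ℂ))).compl₂ (LinearMap.snd ℂ _ _) -
    (symp.comp (LinearMap.fst ℂ (Fin 2 → ℂ) (Fin 2 → ℂ))).compl₂ (LinearMap.fst ℂ _ _)

theorem boundaryForm_apply (p p' : BoundarySpace) :
    boundaryForm p p' = symp p.2 p'.2 - symp p.1 p'.1 := rfl

namespace IsFundamentalPair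

variable {q : ℝ → ℝ} {w₁ w₂ : ℝ → ℂ}

theorem wronskian (hw : IsFundamentalPair q w₁ w₂) (x : ℝ) :
    w₁ x * deriv w₂ x - deriv w₁ x * w₂ x = 1 := by
  rw [← bracket_of_real hw.real₁, hw.bracket_eq_one]

/-- This is the Plücker relation for `2 × 2` minors. -/
theorem bracket_eq (hw : IsFundamentalPair q w₁ w₂) (f g : ℝ → ℂ) (x : ℝ) :
    bracket f g x =
      conj (bracket w₁ f x) * bracket w₂ g x - conj (bracket w₂ f x) * bracket w₁ g x := by
  have h₁ := congrFun (bracket_conj_of_real hw.real₁ f) x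
  have h₂ := congrFun (bracket_conj_of_real hw.real₂ f) x
  rw [← h₁, ← h₂]
  simp only [bracket_of_real hw.real₁, bracket_of_real hw.real₂, deriv_conj]
  rw [bracket]
  linear_combination (conj (deriv f x) * g x - conj (f x) * deriv g x) * hw.wronskian x

theorem tendsto_bracket_atBot (hw : IsFundamentalPair q w₁ w₂) {f g : ℝ → ℂ}
    {α β α' β' : Fin 2 → ℂ} (hf : HasBoundaryValues w₁ w₂ f α β)
    (hg : HasBoundaryValues w₁ w₂ g α' β') : Tendsto (bracket f g) atBot (𝓝 (symp α α')) := by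
  rw [funext (hw.bracket_eq f g), symp_apply]
  exact (hf.alpha₁.star.mul hg.alpha₂).sub (hf.alpha₂.star.mul hg.alpha₁)

theorem tendsto_bracket_atTop (hw : IsFundamentalPair q w₁ w₂) {f g : ℝ → ℂ}
    {α β α' β' : Fin 2 → ℂ} (hf : HasBoundaryValues w₁ w₂ f α β)
    (hg : HasBoundaryValues w₁ w₂ g α' β') : Tendsto (bracket f g) atTop (𝓝 (symp β β')) := by
  rw [funext (hw.bracket_eq f g), symp_apply]
  exact (hf.beta₁.star.mul hg.beta₂).sub (hf.beta₂.star.mul hg.beta₁)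

theorem hasBoundaryValues₁ (hw : IsFundamentalPair q w₁ w₂) :
    HasBoundaryValues w₁ w₂ w₁ ![0, -1] ![0, -1] := by
  have h₁ : bracket w₁ w₁ = fun _ => 0 := funext fun x => by
    rw [bracket_of_real hw.real₁]; ring
  have h₂ : bracket w₂ w₁ = fun _ => -1 := funext fun x => by
    rw [bracket_of_real hw.real₂]; linear_combination -hw.wronskian x
  constructor <;> simp only [h₁, h₂] <;> exact tendsto_const_nhds

theorem hasBoundaryValues₂ (hw : IsFundamentalPair q w₁ w₂) :
    HasBoundaryValues w₁ w₂ w₂ ![1, 0] ![1, 0] := by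
  have h₁ : bracket w₁ w₂ = fun _ => 1 := funext hw.bracket_eq_one
  have h₂ : bracket w₂ w₂ = fun _ => 0 := funext fun x => by
    rw [bracket_of_real hw.real₂]; ring
  constructor <;> simp only [h₁, h₂] <;> exact tendsto_const_nhds

end IsFundamentalPair

/-! ### Variation of constants -/

theorem memLp_mul_integral {w g : ℝ → ℂ} {p : ENNReal} (hw : MemLp w p volume)
    (hg : Integrable g volume) : MemLp (fun x => w x * ∫ t in (0 : ℝ)..x, g t) p volume := by
  have hbound : ∀ x, ‖∫ t in (0 : ℝ)..x, g t‖ ≤ ∫ t, ‖g t‖ := fun x =>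
    intervalIntegral.norm_integral_le_integral_norm_uIoc.trans
      (setIntegral_le_integral hg.norm (ae_of_all _ fun _ => norm_nonneg _))
  exact (memLp_top_of_bound (acLoc_integral hg.locallyIntegrable).continuous.aestronglyMeasurable
    _ (ae_of_all _ hbound)).mul hw

/-- The solution of `τ_q(y) = h` obtained by variation of constants from a fundamental pair. -/
def variationOfConstants (w₁ w₂ h : ℝ → ℂ) (x : ℝ) : ℂ :=
  w₁ x * (∫ t in (0 : ℝ)..x, w₂ t * h t) - w₂ x * ∫ t in (0 : ℝ)..x, w₁ t * h t

theorem hasDerivAt_variationOfConstants {w₁ w₂ h : ℝ → ℂ} (hw₁ : IsRegular w₁)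
    (hw₂ : IsRegular w₂) (h₁ : LocallyIntegrable (fun x => w₁ x * h x) volume)
    (h₂ : LocallyIntegrable (fun x => w₂ x * h x) volume) (x : ℝ) :
    HasDerivAt (variationOfConstants w₁ w₂ h)
      (deriv w₁ x * (∫ t in (0 : ℝ)..x, w₂ t * h t) -
        deriv w₂ x * ∫ t in (0 : ℝ)..x, w₁ t * h t) x := by
  refine ACLoc.hasDerivAt_of_ae_hasDerivAt (z := fun x =>
      deriv w₁ x * (∫ t in (0 : ℝ)..x, w₂ t * h t) - deriv w₂ x * ∫ t in (0 : ℝ)..x, w₁ t * h t)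
    ((hw₁.ac.mul (acLoc_integral h₂)).sub
      (hw₂.ac.mul (acLoc_integral h₁)))
    ((hw₁.ac_deriv.mul (acLoc_integral h₂)).sub
      (hw₂.ac_deriv.mul (acLoc_integral h₁))).continuous ?_ x
  filter_upwards [LocallyIntegrable.ae_hasDerivAt_integral h₁,
    LocallyIntegrable.ae_hasDerivAt_integral h₂] with x hB₁ hB₂
  refine (((hw₁.hasDerivAt x).fun_mul (hB₂ 0)).fun_sub
    ((hw₂.hasDerivAt x).fun_mul (hB₁ 0))).congr_deriv ?_
  ring

theorem IsFundamentalPair.tau_variationOfConstants {q : ℝ → ℝ} {w₁ w₂ h : ℝ → ℂ}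
    (hw : IsFundamentalPair q w₁ w₂) (h₁ : LocallyIntegrable (fun x => w₁ x * h x) volume)
    (h₂ : LocallyIntegrable (fun x => w₂ x * h x) volume) :
    tau q (variationOfConstants w₁ w₂ h) =ᵐ[volume] h := by
  have hderiv := funext fun x =>
    (hasDerivAt_variationOfConstants hw.mem₁.regular hw.mem₂.regular h₁ h₂ x).deriv
  filter_upwards [LocallyIntegrable.ae_hasDerivAt_integral h₁,
    LocallyIntegrable.ae_hasDerivAt_integral h₂, hw.mem₁.regular.ae_hasDerivAt_deriv,
    hw.mem₂.regular.ae_hasDerivAt_deriv, hw.tau₁, hw.tau₂] with x hB₁ hB₂ hw₁ hw₂ hτ₁ hτ₂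
  rw [tau, hderiv, ((hw₁.fun_mul (hB₂ 0)).fun_sub (hw₂.fun_mul (hB₁ 0))).deriv,
    variationOfConstants]
  simp only [tau, Pi.zero_apply] at hτ₁ hτ₂
  linear_combination h x * hw.wronskian x + (∫ t in (0 : ℝ)..x, w₂ t * h t) * hτ₁ -
    (∫ t in (0 : ℝ)..x, w₁ t * h t) * hτ₂

theorem IsFundamentalPair.inMaxDomain_variationOfConstants {q : ℝ → ℝ} {w₁ w₂ h : ℝ → ℂ}
    (hw : IsFundamentalPair q w₁ w₂) (hh : MemLp h 2 volume) :
    InMaxDomain q (variationOfConstants w₁ w₂ h) ∧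
      tau q (variationOfConstants w₁ w₂ h) =ᵐ[volume] h := by
  have h₁ : Integrable (fun x => w₁ x * h x) volume := hw.mem₁.memLp.integrable_mul hh
  have h₂ : Integrable (fun x => w₂ x * h x) volume := hw.mem₂.memLp.integrable_mul hh
  have hB₁ := acLoc_integral h₁.locallyIntegrable
  have hB₂ := acLoc_integral h₂.locallyIntegrable
  have htau := hw.tau_variationOfConstants h₁.locallyIntegrable h₂.locallyIntegrable
  refine ⟨⟨?_, ?_, hh.ae_eq htau.symm⟩, htau⟩
  · exact (memLp_mul_integral hw.mem₁.memLp h₂).sub (memLp_mul_integral hw.mem₂.memLp h₁)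
  · exact .of_hasDerivAt ((hw.mem₁.regular.ac.mul hB₂).sub (hw.mem₂.regular.ac.mul hB₁))
      ((hw.mem₁.regular.ac_deriv.mul hB₂).sub (hw.mem₂.regular.ac_deriv.mul hB₁))
      (hasDerivAt_variationOfConstants hw.mem₁.regular hw.mem₂.regular h₁.locallyIntegrable
        h₂.locallyIntegrable)

/-! ### Boundary data of elements of the maximal graph -/

/-- `f ∈ D_max`, `k = A_max f`, and `p = (α, β)` are the boundary values of `f`. -/
def HasBoundaryData (q : ℝ → ℝ) (w₁ w₂ : ℝ → ℂ) (f k : L2R) (p : BoundarySpace) : Prop :=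
  ∃ y, InMaxDomain q y ∧ f =ᵐ[volume] y ∧ k =ᵐ[volume] tau q y ∧
    HasBoundaryValues w₁ w₂ y p.1 p.2

theorem InMaxDomain.hasBoundaryData {q : ℝ → ℝ} {w₁ w₂ y : ℝ → ℂ} (hy : InMaxDomain q y)
    {k : L2R} (hk : tau q y =ᵐ[volume] k) {p : BoundarySpace}
    (hp : HasBoundaryValues w₁ w₂ y p.1 p.2) :
    HasBoundaryData q w₁ w₂ (hy.memLp.toLp y) k p :=
  ⟨y, hy, hy.memLp.coeFn_toLp, hk.symm, hp⟩

namespace HasBoundaryData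

variable {q : ℝ → ℝ} {w₁ w₂ : ℝ → ℂ} {f f' k k' : L2R} {p p' : BoundarySpace}

theorem add (h : HasBoundaryData q w₁ w₂ f k p) (h' : HasBoundaryData q w₁ w₂ f' k' p') :
    HasBoundaryData q w₁ w₂ (f + f') (k + k') (p + p') := by
  obtain ⟨y, hy, hf, hk, hp⟩ := h
  obtain ⟨y', hy', hf', hk', hp'⟩ := h'
  exact ⟨y + y', hy.add hy', (Lp.coeFn_add f f').trans (hf.add hf'),
    ((Lp.coeFn_add k k').trans (hk.add hk')).trans (tau_add_ae q hy.regular hy'.regular).symm,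
    hp.add hy.regular hy'.regular hp'⟩

theorem smul (c : ℂ) (h : HasBoundaryData q w₁ w₂ f k p) :
    HasBoundaryData q w₁ w₂ (c • f) (c • k) (c • p) := by
  obtain ⟨y, hy, hf, hk, hp⟩ := h
  exact ⟨c • y, hy.smul c, (Lp.coeFn_smul c f).trans (hf.const_smul c),
    ((Lp.coeFn_smul c k).trans (hk.const_smul c)).trans (tau_smul_ae q c hy.regular).symm,
    hp.smul c hy.regular⟩

theorem unique (h : HasBoundaryData q w₁ w₂ f k p) (h' : HasBoundaryData q w₁ w₂ f k' p') :
    k = k' ∧ p = p' := by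
  obtain ⟨y, hy, hf, hk, hp⟩ := h
  obtain ⟨y', hy', hf', hk', hp'⟩ := h'
  obtain rfl := hy.regular.eq_of_ae hy'.regular (hf.symm.trans hf')
  obtain ⟨h₁, h₂⟩ := hp.unique hp'
  exact ⟨Lp.ext (hk.trans hk'.symm), Prod.ext h₁ h₂⟩

end HasBoundaryData

theorem hasBoundaryData_zero (q : ℝ → ℝ) (w₁ w₂ : ℝ → ℂ) : HasBoundaryData q w₁ w₂ 0 0 0 := by
  have htau : tau q 0 =ᵐ[volume] 0 := by
    simpa using tau_smul_ae q 0 (InMaxDomain.zero q).regular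
  exact ⟨0, InMaxDomain.zero q, Lp.coeFn_zero _ _ _, (Lp.coeFn_zero _ _ _).trans htau.symm,
    HasBoundaryValues.zero w₁ w₂⟩

theorem inner_eq_integral {f g : L2R} {y z : ℝ → ℂ} (hf : f =ᵐ[volume] y)
    (hg : g =ᵐ[volume] z) : inner ℂ f g = ∫ x, conj (y x) * z x := by
  rw [L2.inner_def]
  refine integral_congr_ae ?_
  filter_upwards [hf, hg] with x hfx hgx
  rw [hfx, hgx, RCLike.inner_apply, mul_comm]

theorem exists_inner_eq_of_linearIndependent {𝕜 E ι : Type*} [RCLike 𝕜] [NormedAddCommGroup E]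
    [InnerProductSpace 𝕜 E] [Finite ι] {v : ι → E} (hv : LinearIndependent 𝕜 v) (c : ι → 𝕜) :
    ∃ x, ∀ i, inner 𝕜 (v i) x = c i := by
  classical
  cases nonempty_fintype ι
  have hdet : IsUnit (Matrix.gram 𝕜 v).det :=
    (Matrix.det_gram_ne_zero_iff_linearIndependent.2 hv).isUnit
  refine ⟨∑ j, ((Matrix.gram 𝕜 v)⁻¹ *ᵥ c) j • v j, fun i => ?_⟩
  calc inner 𝕜 (v i) (∑ j, ((Matrix.gram 𝕜 v)⁻¹ *ᵥ c) j • v j)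
      = (Matrix.gram 𝕜 v *ᵥ ((Matrix.gram 𝕜 v)⁻¹ *ᵥ c)) i := by
        simp only [inner_sum, inner_smul_right, Matrix.mulVec, dotProduct, Matrix.gram_apply,
          mul_comm]
    _ = c i := by
        rw [Matrix.mulVec_mulVec, Matrix.mul_nonsing_inv _ hdet, Matrix.one_mulVec]

namespace IsFundamentalPair

variable {q : ℝ → ℝ} {w₁ w₂ : ℝ → ℂ}

theorem inner_sub_inner (hw : IsFundamentalPair q w₁ w₂) {f k g l : L2R} {p p' : BoundarySpace}
    (h : HasBoundaryData q w₁ w₂ f k p) (h' : HasBoundaryData q w₁ w₂ g l p') :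
    inner ℂ k g - inner ℂ f l = boundaryForm p p' := by
  obtain ⟨y, hy, hf, hk, hp⟩ := h
  obtain ⟨z, hz, hg, hl, hp'⟩ := h'
  rw [inner_eq_integral hk hg, inner_eq_integral hf hl,
    ← integral_sub (hy.integrable_conj_tau_mul hz) (hy.integrable_conj_mul_tau hz)]
  exact hy.integral_green hz (hw.tendsto_bracket_atBot hp hp') (hw.tendsto_bracket_atTop hp hp')

/-- The solution of `τ_q(y) = 0` whose boundary values at both endpoints are `α`. -/
def nullSolution (hw : IsFundamentalPair q w₁ w₂) : (Fin 2 → ℂ) →ₗ[ℂ] L2R :=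
  (LinearMap.proj 0).smulRight (hw.mem₂.memLp.toLp w₂) -
    (LinearMap.proj 1).smulRight (hw.mem₁.memLp.toLp w₁)

theorem hasBoundaryData_nullSolution (hw : IsFundamentalPair q w₁ w₂) (α : Fin 2 → ℂ) :
    HasBoundaryData q w₁ w₂ (hw.nullSolution α) 0 (α, α) := by
  have hzero : (0 : ℝ → ℂ) =ᵐ[volume] (0 : L2R) := (Lp.coeFn_zero _ _ _).symm
  have h₁ := hw.mem₁.hasBoundaryData (hw.tau₁.trans hzero) (p := (_, _)) hw.hasBoundaryValues₁
  have h₂ := hw.mem₂.hasBoundaryData (hw.tau₂.trans hzero) (p := (_, _)) hw.hasBoundaryValues₂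
  have hα : α 0 • ![1, 0] + -α 1 • ![0, -1] = α := by
    funext i
    fin_cases i <;> simp
  convert (h₂.smul (α 0)).add (h₁.smul (-α 1)) using 1
  · rw [neg_smul, ← sub_eq_add_neg]
    rfl
  · rw [smul_zero, smul_zero, add_zero]
  · exact Prod.ext hα.symm hα.symm

theorem nullSolution_injective (hw : IsFundamentalPair q w₁ w₂) :
    Function.Injective hw.nullSolution := by
  rw [injective_iff_map_eq_zero]
  intro α hα
  have h := hw.hasBoundaryData_nullSolution α
  rw [hα] at h
  exact congrArg Prod.fst (h.unique (hasBoundaryData_zero q w₁ w₂)).2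

theorem inner_nullSolution (hw : IsFundamentalPair q w₁ w₂) {f k : L2R} {p : BoundarySpace}
    (h : HasBoundaryData q w₁ w₂ f k p) (γ : Fin 2 → ℂ) :
    inner ℂ (hw.nullSolution γ) k = symp γ (p.1 - p.2) := by
  have hgreen := hw.inner_sub_inner (hw.hasBoundaryData_nullSolution γ) h
  rw [inner_zero_left, boundaryForm_apply] at hgreen
  rw [map_sub]
  linear_combination -hgreen

theorem exists_hasBoundaryData_of_fst (hw : IsFundamentalPair q w₁ w₂) (k : L2R)
    (α : Fin 2 → ℂ) : ∃ f β, HasBoundaryData q w₁ w₂ f k (α, β) := by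
  obtain ⟨hy, htau⟩ := hw.inMaxDomain_variationOfConstants (Lp.memLp k)
  obtain ⟨α', β', hp⟩ := hw.mem₁.exists_hasBoundaryValues hw.mem₂ hy
  have h := (hy.hasBoundaryData htau (p := (α', β')) hp).add
    (hw.hasBoundaryData_nullSolution (α - α'))
  rw [add_zero, Prod.mk_add_mk, add_sub_cancel] at h
  exact ⟨_, _, h⟩

theorem exists_hasBoundaryData (hw : IsFundamentalPair q w₁ w₂) (p : BoundarySpace) :
    ∃ f k, HasBoundaryData q w₁ w₂ f k p := by
  have hindep : LinearIndependent ℂ fun i => hw.nullSolution (Pi.single i 1) := by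
    simpa [Function.comp_def] using (Pi.basisFun ℂ (Fin 2)).linearIndependent.map'
      hw.nullSolution (LinearMap.ker_eq_bot.2 hw.nullSolution_injective)
  obtain ⟨k, hk⟩ := exists_inner_eq_of_linearIndependent hindep
    fun i => symp (Pi.single i 1) (p.1 - p.2)
  obtain ⟨f, β, h⟩ := hw.exists_hasBoundaryData_of_fst k p.1
  have hβ : p.1 - β = p.1 - p.2 := symp_ext fun i => (hw.inner_nullSolution h _).symm.trans (hk i)
  rw [sub_right_inj] at hβ
  exact ⟨f, k, by rwa [hβ] at h⟩

/-- The minimal operator is the one with boundary values `0`, so this is the inclusion of its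
adjoint in the maximal operator. -/
theorem exists_hasBoundaryData_of_inner_eq (hw : IsFundamentalPair q w₁ w₂) {g l : L2R}
    (H : ∀ f k, HasBoundaryData q w₁ w₂ f k 0 → inner ℂ k g = inner ℂ f l) :
    ∃ p, HasBoundaryData q w₁ w₂ g l p := by
  obtain ⟨g₀, β₀, h₀⟩ := hw.exists_hasBoundaryData_of_fst l 0
  have hmem : g - g₀ ∈ (LinearMap.range hw.nullSolution)ᗮᗮ := by
    rw [Submodule.mem_orthogonal]
    intro k hk
    obtain ⟨f, β, hf⟩ := hw.exists_hasBoundaryData_of_fst k 0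
    have hβ : β = 0 := symp_ext fun i => by
      have hi := hw.inner_nullSolution hf (Pi.single i 1)
      rw [(Submodule.mem_orthogonal _ _).1 hk _ ⟨Pi.single i 1, rfl⟩, zero_sub, map_neg] at hi
      rw [map_zero, ← neg_eq_zero, ← hi]
    rw [hβ] at hf
    have hgreen := hw.inner_sub_inner hf h₀
    rw [Prod.mk_zero_zero, map_zero, LinearMap.zero_apply, sub_eq_zero] at hgreen
    rw [inner_sub_right, H f k hf, hgreen, sub_self]
  rw [Submodule.orthogonal_orthogonal] at hmem
  obtain ⟨α, hα⟩ := hmem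
  have h := h₀.add (hw.hasBoundaryData_nullSolution α)
  rw [hα, add_sub_cancel, add_zero] at h
  exact ⟨_, h⟩

end IsFundamentalPair

/-! ### Parity and time reversal -/

theorem parity_ae_eq {f : L2R} {y : ℝ → ℂ} (h : f =ᵐ[volume] y) :
    parity f =ᵐ[volume] fun x => y (-x) :=
  EventuallyEq.trans (parity_ae f)
    ((Measure.measurePreserving_neg (volume : Measure ℝ)).quasiMeasurePreserving.ae_eq_comp h)

theorem timeReversal_ae_eq {f : L2R} {y : ℝ → ℂ} (h : f =ᵐ[volume] y) :
    timeReversal f =ᵐ[volume] fun x => conj (y x) := by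
  filter_upwards [timeReversal_ae f, h] with x hx hfx
  rw [hx, hfx]

theorem parity_parity (f : L2R) : parity (parity f) = f := by
  refine Lp.ext ((parity_ae_eq (parity_ae_eq (EventuallyEq.refl _ f))).trans ?_)
  simp only [neg_neg]
  exact EventuallyEq.refl _ _

/-- The action of `P` on boundary values: the two endpoints are exchanged. -/
def reflect (p : BoundarySpace) : BoundarySpace := (reflection *ᵥ p.2, reflection *ᵥ p.1)

theorem HasBoundaryData.parity {q : ℝ → ℝ} (hq : Function.Even q) {w₁ w₂ : ℝ → ℂ}
    (h₁ : Function.Odd w₁) (h₂ : Function.Even w₂) {f k : L2R} {p : BoundarySpace}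
    (h : HasBoundaryData q w₁ w₂ f k p) :
    HasBoundaryData q w₁ w₂ (parity f) (parity k) (reflect p) := by
  obtain ⟨y, hy, hf, hk, hp⟩ := h
  refine ⟨_, hy.comp_neg hq, parity_ae_eq hf, ?_, hp.comp_neg h₁ h₂⟩
  rw [tau_comp_neg hq]
  exact parity_ae_eq hk

theorem HasBoundaryData.timeReversal {q : ℝ → ℝ} {w₁ w₂ : ℝ → ℂ} (h₁ : ∀ x, (w₁ x).im = 0)
    (h₂ : ∀ x, (w₂ x).im = 0) {f k : L2R} {p : BoundarySpace}
    (h : HasBoundaryData q w₁ w₂ f k p) :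
    HasBoundaryData q w₁ w₂ (timeReversal f) (timeReversal k) (star p) := by
  obtain ⟨y, hy, hf, hk, hp⟩ := h
  refine ⟨_, hy.conj, timeReversal_ae_eq hf, ?_, hp.conj h₁ h₂⟩
  rw [tau_conj]
  exact timeReversal_ae_eq hk

theorem isPSelfAdjoint_iff_graph {H : L2R →ₗ.[ℂ] L2R} :
    IsPSelfAdjoint H ↔ H.IsClosed ∧ Dense (H.domain : Set L2R) ∧
      ∀ f k : L2R, (f, k) ∈ H.graph ↔ (parity f, parity k) ∈ H.adjoint.graph := by
  refine and_congr_right fun _ => and_congr_right fun _ => ⟨?_, fun h => ?_⟩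
  · rintro ⟨hdom, hval⟩ f k
    constructor <;> intro hfk <;> have hf := LinearPMap.mem_domain_of_mem_graph hfk
    · rw [← LinearPMap.image_iff ((hdom f).1 hf), (LinearPMap.image_iff hf).2 hfk,
        hval f hf ((hdom f).1 hf), parity_parity]
    · rw [← LinearPMap.image_iff ((hdom f).2 hf), hval f ((hdom f).2 hf) hf,
        ← (LinearPMap.image_iff hf).2 hfk, parity_parity]
  · refine ⟨fun f => ⟨fun hf => ?_, fun hf => ?_⟩, fun f hf hf' => ?_⟩
    · exact LinearPMap.mem_domain_of_mem_graph ((h f _).1 (H.mem_graph ⟨f, hf⟩))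
    · refine LinearPMap.mem_domain_of_mem_graph
        ((h f (parity (H.adjoint ⟨parity f, hf⟩))).2 ?_)
      rw [parity_parity]
      exact H.adjoint.mem_graph ⟨parity f, hf⟩
    · have hgraph := (h f _).1 (H.mem_graph ⟨f, hf⟩)
      rw [← (LinearPMap.image_iff hf').2 hgraph, parity_parity]

theorem isPTSymmetric_iff_graph {H : L2R →ₗ.[ℂ] L2R} :
    IsPTSymmetric H ↔ H.IsClosed ∧ Dense (H.domain : Set L2R) ∧
      ∀ f k : L2R, (f, k) ∈ H.graph → (PT f, PT k) ∈ H.graph := by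
  refine and_congr_right fun _ => and_congr_right fun _ => ⟨fun h f k hfk => ?_, ?_⟩
  · have hf := LinearPMap.mem_domain_of_mem_graph hfk
    obtain ⟨hPT, hval⟩ := h ⟨f, hf⟩
    rw [← LinearPMap.image_iff hPT, (LinearPMap.image_iff hf).2 hfk, hval]
  · rintro h ⟨f, hf⟩
    have hgraph := h f _ (H.mem_graph ⟨f, hf⟩)
    exact ⟨LinearPMap.mem_domain_of_mem_graph hgraph, (LinearPMap.image_iff _).2 hgraph⟩

/-! ### Restrictions of the maximal operator by boundary conditions -/

/-- The restriction of the maximal operator to the functions whose boundary values lie in `S`;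
`mixedOp₁` and `mixedOp₂` are the cases in which `S` is the graph of a matrix. -/
def relOp (q : ℝ → ℝ) (w₁ w₂ : ℝ → ℂ) (S : Submodule ℂ BoundarySpace) : L2R →ₗ.[ℂ] L2R :=
  (maxOp q).domRestrict (boundaryDomain q w₁ w₂ S)

/-- The orthogonal complement for the boundary form. -/
def orth (S : Submodule ℂ BoundarySpace) : Submodule ℂ BoundarySpace :=
  S.orthogonalBilin boundaryForm

theorem mem_orth {S : Submodule ℂ BoundarySpace} {p : BoundarySpace} :
    p ∈ orth S ↔ ∀ s ∈ S, boundaryForm s p = 0 := Submodule.mem_orthogonalBilin_iff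

theorem maxOp_apply {q : ℝ → ℝ} {f : maxDomain q} {y : ℝ → ℂ} (hy : InMaxDomain q y)
    (hfy : (f : L2R) =ᵐ[volume] y) : maxOp q f =ᵐ[volume] tau q y := by
  rw [← rep_eq f hy.regular hfy]
  exact (rep_inMaxDomain f).memLp_tau.coeFn_toLp

theorem mem_graph_relOp {q : ℝ → ℝ} {w₁ w₂ : ℝ → ℂ} {S : Submodule ℂ BoundarySpace}
    {f k : L2R} :
    (f, k) ∈ (relOp q w₁ w₂ S).graph ↔ ∃ p ∈ S, HasBoundaryData q w₁ w₂ f k p := by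
  rw [LinearPMap.mem_graph_iff]
  constructor
  · rintro ⟨⟨f', hf'⟩, rfl, rfl⟩
    obtain ⟨y, hy, hfy, α, β, hp, hS⟩ := hf'.1
    exact ⟨(α, β), hS, y, hy, hfy, maxOp_apply (f := ⟨f', hf'.2⟩) hy hfy, hp⟩
  · rintro ⟨p, hS, y, hy, hfy, hky, hp⟩
    have hf : f ∈ maxDomain q := ⟨y, hy, hfy⟩
    exact ⟨⟨f, ⟨y, hy, hfy, p.1, p.2, hp, hS⟩, hf⟩, rfl,
      Lp.ext ((maxOp_apply (f := ⟨f, hf⟩) hy hfy).trans hky.symm)⟩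

theorem HasBoundaryData.mem_graph_relOp_iff {q : ℝ → ℝ} {w₁ w₂ : ℝ → ℂ}
    {S : Submodule ℂ BoundarySpace} {f k : L2R} {p : BoundarySpace}
    (h : HasBoundaryData q w₁ w₂ f k p) : (f, k) ∈ (relOp q w₁ w₂ S).graph ↔ p ∈ S := by
  rw [mem_graph_relOp]
  refine ⟨?_, fun hp => ⟨p, hp, h⟩⟩
  rintro ⟨p', hp', h'⟩
  rwa [(h.unique h').2]

namespace IsFundamentalPair

variable {q : ℝ → ℝ} {w₁ w₂ : ℝ → ℂ}

theorem dense_domain_relOp (hw : IsFundamentalPair q w₁ w₂) (S : Submodule ℂ BoundarySpace) :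
    Dense ((relOp q w₁ w₂ S).domain : Set L2R) := by
  rw [Submodule.dense_iff_topologicalClosure_eq_top, Submodule.topologicalClosure_eq_top_iff,
    Submodule.eq_bot_iff]
  intro l hl
  obtain ⟨p, hp⟩ := hw.exists_hasBoundaryData_of_inner_eq (g := 0) (l := l) fun f k h => by
    have hf := LinearPMap.mem_domain_of_mem_graph (h.mem_graph_relOp_iff.2 S.zero_mem)
    rw [inner_zero_right, (Submodule.mem_orthogonal _ _).1 hl f hf]
  exact (hp.unique (hasBoundaryData_zero q w₁ w₂)).1

theorem adjoint_relOp (hw : IsFundamentalPair q w₁ w₂) (S : Submodule ℂ BoundarySpace) :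
    (relOp q w₁ w₂ S).adjoint = relOp q w₁ w₂ (orth S) := by
  apply LinearPMap.eq_of_eq_graph
  rw [LinearPMap.adjoint_graph_eq_graph_adjoint (hw.dense_domain_relOp S)]
  ext ⟨g, l⟩
  rw [Submodule.mem_adjoint_iff]
  constructor
  · intro H
    obtain ⟨p, hp⟩ := hw.exists_hasBoundaryData_of_inner_eq fun f k h =>
      sub_eq_zero.1 (H f k (h.mem_graph_relOp_iff.2 S.zero_mem))
    refine hp.mem_graph_relOp_iff.2 (mem_orth.2 fun s hs => ?_)
    obtain ⟨f, k, h⟩ := hw.exists_hasBoundaryData s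
    rw [← hw.inner_sub_inner h hp, H f k (h.mem_graph_relOp_iff.2 hs)]
  · intro hgl f k hfk
    obtain ⟨p, hp, h⟩ := mem_graph_relOp.1 hgl
    obtain ⟨s, hs, h'⟩ := mem_graph_relOp.1 hfk
    rw [hw.inner_sub_inner h' h, mem_orth.1 hp s hs]

theorem relOp_injective (hw : IsFundamentalPair q w₁ w₂) :
    Function.Injective (relOp q w₁ w₂) := by
  intro S S' hS
  ext p
  obtain ⟨f, k, h⟩ := hw.exists_hasBoundaryData p
  rw [← h.mem_graph_relOp_iff, hS, h.mem_graph_relOp_iff]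

theorem isSelfAdjoint_relOp_iff (hw : IsFundamentalPair q w₁ w₂) (S : Submodule ℂ BoundarySpace) :
    IsSelfAdjoint (relOp q w₁ w₂ S) ↔ orth S = S := by
  rw [LinearPMap.isSelfAdjoint_def, hw.adjoint_relOp, hw.relOp_injective.eq_iff]

theorem isClosed_relOp (hw : IsFundamentalPair q w₁ w₂) {S : Submodule ℂ BoundarySpace}
    (hS : orth (orth S) = S) : (relOp q w₁ w₂ S).IsClosed := by
  rw [← hS, ← hw.adjoint_relOp]
  exact LinearPMap.adjoint_isClosed (hw.dense_domain_relOp _)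

theorem isPSelfAdjoint_relOp_iff (hw : IsFundamentalPair q w₁ w₂) (hq : Function.Even q)
    (h₁ : Function.Odd w₁) (h₂ : Function.Even w₂) {S : Submodule ℂ BoundarySpace}
    (hS : orth (orth S) = S) :
    IsPSelfAdjoint (relOp q w₁ w₂ S) ↔ ∀ p, p ∈ S ↔ reflect p ∈ orth S := by
  have key : ∀ {f k p}, HasBoundaryData q w₁ w₂ f k p →
      (((f, k) ∈ (relOp q w₁ w₂ S).graph ↔
        (parity f, parity k) ∈ (relOp q w₁ w₂ (orth S)).graph) ↔ (p ∈ S ↔ reflect p ∈ orth S)) :=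
    fun h => by rw [h.mem_graph_relOp_iff, (h.parity hq h₁ h₂).mem_graph_relOp_iff]
  rw [isPSelfAdjoint_iff_graph, hw.adjoint_relOp]
  constructor
  · rintro ⟨-, -, hgraph⟩ p
    obtain ⟨f, k, h⟩ := hw.exists_hasBoundaryData p
    exact (key h).1 (hgraph f k)
  · intro H
    refine ⟨hw.isClosed_relOp hS, hw.dense_domain_relOp S, fun f k => ⟨fun hfk => ?_,
      fun hfk => ?_⟩⟩ <;> obtain ⟨p, -, h⟩ := mem_graph_relOp.1 hfk
    · exact ((key h).2 (H p)).1 hfk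
    · have h' := h.parity hq h₁ h₂
      rw [parity_parity, parity_parity] at h'
      exact ((key h').2 (H _)).2 hfk

theorem isPTSymmetric_relOp_iff (hw : IsFundamentalPair q w₁ w₂) (hq : Function.Even q)
    (h₁ : Function.Odd w₁) (h₂ : Function.Even w₂) {S : Submodule ℂ BoundarySpace}
    (hS : orth (orth S) = S) :
    IsPTSymmetric (relOp q w₁ w₂ S) ↔ ∀ p ∈ S, reflect (star p) ∈ S := by
  have key : ∀ {f k p}, HasBoundaryData q w₁ w₂ f k p →
      ((PT f, PT k) ∈ (relOp q w₁ w₂ S).graph ↔ reflect (star p) ∈ S) := fun h =>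
    ((h.timeReversal hw.real₁ hw.real₂).parity hq h₁ h₂).mem_graph_relOp_iff
  rw [isPTSymmetric_iff_graph]
  constructor
  · rintro ⟨-, -, hgraph⟩ p hp
    obtain ⟨f, k, h⟩ := hw.exists_hasBoundaryData p
    exact (key h).1 (hgraph f k (h.mem_graph_relOp_iff.2 hp))
  · intro H
    refine ⟨hw.isClosed_relOp hS, hw.dense_domain_relOp S, fun f k hfk => ?_⟩
    obtain ⟨p, hp, h⟩ := mem_graph_relOp.1 hfk
    exact (key h).2 (H p hp)

end IsFundamentalPair

/-! ### Mixed boundary conditions -/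

section Mixed

variable (M : Matrix (Fin 2) (Fin 2) ℂ)

/-- The adjoint of a matrix with respect to `symp`. -/
def sympAdjoint : Matrix (Fin 2) (Fin 2) ℂ := (M.map conj).adjugate

theorem sympAdjoint_sympAdjoint : sympAdjoint (sympAdjoint M) = M := by
  ext i j
  fin_cases i <;> fin_cases j <;> simp [sympAdjoint, Matrix.adjugate_fin_two]

theorem symp_mulVec (u v : Fin 2 → ℂ) : symp (M *ᵥ u) v = symp u (sympAdjoint M *ᵥ v) := by
  simp only [symp_apply, sympAdjoint, Matrix.adjugate_fin_two, Matrix.mulVec, dotProduct,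
    Fin.sum_univ_two, Matrix.map_apply, Matrix.of_apply, Matrix.cons_val', Matrix.cons_val_zero,
    Matrix.cons_val_one, Matrix.cons_val_fin_one, map_add, map_mul]
  ring

theorem orth_mixedRel₁ : orth (mixedRel₁ M) = mixedRel₂ (sympAdjoint M) := by
  ext p
  rw [mem_orth]
  constructor
  · intro h
    refine symp_ext fun i => ?_
    rw [← symp_mulVec]
    exact sub_eq_zero.1 (h (M *ᵥ Pi.single i 1, Pi.single i 1) rfl)
  · rintro (hp : p.2 = sympAdjoint M *ᵥ p.1) s (hs : s.1 = M *ᵥ s.2)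
    rw [boundaryForm_apply, hp, hs, symp_mulVec, sub_self]

theorem orth_mixedRel₂ : orth (mixedRel₂ M) = mixedRel₁ (sympAdjoint M) := by
  ext p
  rw [mem_orth]
  constructor
  · intro h
    refine symp_ext fun i => ?_
    rw [← symp_mulVec]
    exact (sub_eq_zero.1 (h (Pi.single i 1, M *ᵥ Pi.single i 1) rfl)).symm
  · rintro (hp : p.1 = sympAdjoint M *ᵥ p.2) s (hs : s.2 = M *ᵥ s.1)
    rw [boundaryForm_apply, hp, hs, symp_mulVec, sub_self]

theorem orth_orth_mixedRel₁ : orth (orth (mixedRel₁ M)) = mixedRel₁ M := by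
  rw [orth_mixedRel₁, orth_mixedRel₂, sympAdjoint_sympAdjoint]

theorem orth_orth_mixedRel₂ : orth (orth (mixedRel₂ M)) = mixedRel₂ M := by
  rw [orth_mixedRel₂, orth_mixedRel₁, sympAdjoint_sympAdjoint]

/-- `M` preserves `symp`: the matrix form of self-adjointness. -/
def IsSympUnitary : Prop := sympAdjoint M * M = 1

/-- `M` is self-adjoint for the form `symp (reflection *ᵥ u) v`: the matrix form of
`P`-self-adjointness. -/
def IsReflectionSelfAdjoint : Prop := M = reflection * sympAdjoint M * reflection

/-- The antilinear map `v ↦ reflection *ᵥ conj (M *ᵥ v)` is an involution: the matrix form of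
`PT` symmetry. -/
def IsReflectionConjInvolutive : Prop := reflection * M.map conj * reflection * M = 1

variable {M} {N : Matrix (Fin 2) (Fin 2) ℂ} {p : BoundarySpace}

theorem mixedRel₁_le_mixedRel₂_iff : mixedRel₁ M ≤ mixedRel₂ N ↔ N * M = 1 := by
  constructor
  · intro h
    refine Matrix.mulVec_injective (funext fun β => ?_)
    rw [← Matrix.mulVec_mulVec, Matrix.one_mulVec]
    exact (h (show (M *ᵥ β, β) ∈ mixedRel₁ M from rfl)).symm
  · intro h p (hp : p.1 = M *ᵥ p.2)
    change p.2 = N *ᵥ p.1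
    rw [hp, Matrix.mulVec_mulVec, h, Matrix.one_mulVec]

theorem mixedRel₂_le_mixedRel₁_iff : mixedRel₂ M ≤ mixedRel₁ N ↔ N * M = 1 := by
  constructor
  · intro h
    refine Matrix.mulVec_injective (funext fun α => ?_)
    rw [← Matrix.mulVec_mulVec, Matrix.one_mulVec]
    exact (h (show (α, M *ᵥ α) ∈ mixedRel₂ M from rfl)).symm
  · intro h p (hp : p.2 = M *ᵥ p.1)
    change p.1 = N *ᵥ p.2
    rw [hp, Matrix.mulVec_mulVec, h, Matrix.one_mulVec]

theorem mixedRel₁_eq_mixedRel₂_iff : mixedRel₁ M = mixedRel₂ N ↔ N * M = 1 := by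
  rw [le_antisymm_iff, mixedRel₁_le_mixedRel₂_iff, mixedRel₂_le_mixedRel₁_iff,
    mul_eq_one_comm (a := M), and_self]

theorem mixedRel₁_injective : Function.Injective mixedRel₁ := fun M N h =>
  Matrix.mulVec_injective (funext fun β =>
    show (M *ᵥ β, β) ∈ mixedRel₁ N from h ▸ show (M *ᵥ β, β) ∈ mixedRel₁ M from rfl)

theorem mixedRel₂_injective : Function.Injective mixedRel₂ := fun M N h =>
  Matrix.mulVec_injective (funext fun α =>
    show (α, M *ᵥ α) ∈ mixedRel₂ N from h ▸ show (α, M *ᵥ α) ∈ mixedRel₂ M from rfl)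

theorem reflection_mulVec_eq_iff {u v : Fin 2 → ℂ} :
    reflection *ᵥ u = M *ᵥ (reflection *ᵥ v) ↔ u = (reflection * M * reflection) *ᵥ v := by
  simp only [← Matrix.mulVec_mulVec]
  have hinv : Function.Involutive (reflection *ᵥ ·) := fun w => by
    simp only [Matrix.mulVec_mulVec, reflection_mul_self, Matrix.one_mulVec]
  exact hinv.eq_iff

theorem reflect_mem_mixedRel₁_iff :
    reflect p ∈ mixedRel₁ M ↔ p ∈ mixedRel₂ (reflection * M * reflection) :=
  reflection_mulVec_eq_iff

theorem reflect_mem_mixedRel₂_iff :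
    reflect p ∈ mixedRel₂ M ↔ p ∈ mixedRel₁ (reflection * M * reflection) :=
  reflection_mulVec_eq_iff

theorem star_eq_mulVec_star_iff {u v : Fin 2 → ℂ} :
    star u = M *ᵥ star v ↔ u = M.map conj *ᵥ v := by
  rw [star_eq_iff_star_eq, eq_comm, Matrix.star_mulVec, star_star, ← Matrix.mulVec_transpose]
  rfl

theorem star_mem_mixedRel₁_iff : star p ∈ mixedRel₁ M ↔ p ∈ mixedRel₁ (M.map conj) :=
  star_eq_mulVec_star_iff

theorem star_mem_mixedRel₂_iff : star p ∈ mixedRel₂ M ↔ p ∈ mixedRel₂ (M.map conj) :=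
  star_eq_mulVec_star_iff

theorem reflection_mul_mul_map_conj :
    (reflection * M * reflection).map conj = reflection * M.map conj * reflection := by
  have h : reflection.map conj = reflection := by
    ext i j
    fin_cases i <;> fin_cases j <;> simp [reflection]
  rw [Matrix.map_mul, Matrix.map_mul, h]

section Operator

variable {q : ℝ → ℝ} {w₁ w₂ : ℝ → ℂ} {A : L2R →ₗ.[ℂ] L2R}

theorem IsFundamentalPair.isSelfAdjoint_iff_isSympUnitary (hw : IsFundamentalPair q w₁ w₂)
    (hA : A = mixedOp₁ q w₁ w₂ M ∨ A = mixedOp₂ q w₁ w₂ M) :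
    IsSelfAdjoint A ↔ IsSympUnitary M := by
  rcases hA with rfl | rfl
  · refine (hw.isSelfAdjoint_relOp_iff _).trans ?_
    rw [orth_mixedRel₁, eq_comm, mixedRel₁_eq_mixedRel₂_iff, IsSympUnitary]
  · refine (hw.isSelfAdjoint_relOp_iff _).trans ?_
    rw [orth_mixedRel₂, mixedRel₁_eq_mixedRel₂_iff, mul_eq_one_comm, IsSympUnitary]

theorem IsFundamentalPair.isPSelfAdjoint_iff_isReflectionSelfAdjoint
    (hw : IsFundamentalPair q w₁ w₂) (hq : Function.Even q) (h₁ : Function.Odd w₁)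
    (h₂ : Function.Even w₂) (hA : A = mixedOp₁ q w₁ w₂ M ∨ A = mixedOp₂ q w₁ w₂ M) :
    IsPSelfAdjoint A ↔ IsReflectionSelfAdjoint M := by
  rcases hA with rfl | rfl
  · refine (hw.isPSelfAdjoint_relOp_iff hq h₁ h₂ (orth_orth_mixedRel₁ M)).trans ?_
    simp only [orth_mixedRel₁, reflect_mem_mixedRel₂_iff, ← SetLike.ext_iff,
      mixedRel₁_injective.eq_iff, IsReflectionSelfAdjoint]
  · refine (hw.isPSelfAdjoint_relOp_iff hq h₁ h₂ (orth_orth_mixedRel₂ M)).trans ?_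
    simp only [orth_mixedRel₂, reflect_mem_mixedRel₁_iff, ← SetLike.ext_iff,
      mixedRel₂_injective.eq_iff, IsReflectionSelfAdjoint]

theorem IsFundamentalPair.isPTSymmetric_iff_isReflectionConjInvolutive
    (hw : IsFundamentalPair q w₁ w₂) (hq : Function.Even q) (h₁ : Function.Odd w₁)
    (h₂ : Function.Even w₂) (hA : A = mixedOp₁ q w₁ w₂ M ∨ A = mixedOp₂ q w₁ w₂ M) :
    IsPTSymmetric A ↔ IsReflectionConjInvolutive M := by
  rcases hA with rfl | rfl
  · refine (hw.isPTSymmetric_relOp_iff hq h₁ h₂ (orth_orth_mixedRel₁ M)).trans ?_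
    simp only [reflect_mem_mixedRel₁_iff, star_mem_mixedRel₂_iff, reflection_mul_mul_map_conj,
      ← SetLike.le_def, mixedRel₁_le_mixedRel₂_iff, IsReflectionConjInvolutive]
  · refine (hw.isPTSymmetric_relOp_iff hq h₁ h₂ (orth_orth_mixedRel₂ M)).trans ?_
    simp only [reflect_mem_mixedRel₂_iff, star_mem_mixedRel₁_iff, reflection_mul_mul_map_conj,
      ← SetLike.le_def, mixedRel₂_le_mixedRel₁_iff, IsReflectionConjInvolutive]

end Operator

end Mixed

/-! ### The conditions on the coefficients -/

section Coefficients

theorem isSympUnitary_iff {M : Matrix (Fin 2) (Fin 2) ℂ} :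
    IsSympUnitary M ↔ conj M.det * M.det = 1 ∧ M = M.det • M.map conj := by
  have hdet : (M.map conj).det = conj M.det := (RingHom.map_det _ M).symm
  rw [IsSympUnitary]
  constructor
  · intro h
    have hdet_one : conj M.det * M.det = 1 := by
      have h' := congrArg Matrix.det h
      rwa [Matrix.det_mul, sympAdjoint, Matrix.det_adjugate, Fintype.card_fin, pow_one, hdet,
        Matrix.det_one] at h'
    refine ⟨hdet_one, ?_⟩
    calc M = (conj M.det * M.det) • M := by rw [hdet_one, one_smul]
      _ = M.det • (M.map conj * sympAdjoint M * M) := by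
        rw [sympAdjoint, Matrix.mul_adjugate, hdet, Matrix.smul_mul, one_mul, smul_smul, mul_comm]
      _ = M.det • M.map conj := by rw [mul_assoc, h, mul_one]
  · rintro ⟨hdet_one, hM⟩
    calc sympAdjoint M * M = sympAdjoint M * (M.det • M.map conj) := by rw [← hM]
      _ = (conj M.det * M.det) • (1 : Matrix (Fin 2) (Fin 2) ℂ) := by
        rw [Matrix.mul_smul, sympAdjoint, Matrix.adjugate_mul, hdet, smul_smul, mul_comm]
      _ = 1 := by rw [hdet_one, one_smul]

variable {a b c d : ℂ}

theorem fin_two_eq_iff {R : Type*} {a b c d a' b' c' d' : R} :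
    !![a, b; c, d] = !![a', b'; c', d'] ↔ a = a' ∧ b = b' ∧ c = c' ∧ d = d' := by
  simp [and_assoc]

theorem sympAdjoint_fin_two :
    sympAdjoint !![a, b; c, d] = !![conj d, -conj b; -conj c, conj a] := by
  simp [sympAdjoint, Matrix.adjugate_fin_two]

theorem reflection_mul_fin_two_mul_reflection :
    reflection * !![a, b; c, d] * reflection = !![a, -b; -c, d] := by
  simp [reflection]

theorem map_conj_fin_two :
    !![a, b; c, d].map conj = !![conj a, conj b; conj c, conj d] := by
  ext i j
  fin_cases i <;> fin_cases j <;> rfl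

theorem isReflectionSelfAdjoint_fin_two_iff :
    IsReflectionSelfAdjoint !![a, b; c, d] ↔ b.im = 0 ∧ c.im = 0 ∧ d = conj a := by
  rw [IsReflectionSelfAdjoint, sympAdjoint_fin_two, reflection_mul_fin_two_mul_reflection,
    fin_two_eq_iff, neg_neg, neg_neg, ← Complex.conj_eq_iff_im, ← Complex.conj_eq_iff_im,
    eq_comm (a := conj b), eq_comm (a := conj c)]
  refine and_iff_right_of_imp ?_
  rintro ⟨-, -, rfl⟩
  rw [Complex.conj_conj]

theorem isReflectionConjInvolutive_fin_two_iff :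
    IsReflectionConjInvolutive !![a, b; c, d] ↔
      conj a * a - conj b * c = 1 ∧ conj a * b = conj b * d ∧
        conj d * c = conj c * a ∧ conj d * d - conj c * b = 1 := by
  rw [IsReflectionConjInvolutive, map_conj_fin_two, reflection_mul_fin_two_mul_reflection,
    Matrix.mul_fin_two, Matrix.one_fin_two, fin_two_eq_iff, neg_mul, neg_mul, neg_mul, neg_mul,
    ← sub_eq_add_neg, ← sub_eq_add_neg, sub_eq_zero, neg_add_eq_zero, neg_add_eq_sub,
    eq_comm (a := conj c * a)]

theorem isSympUnitary_and_isReflectionSelfAdjoint_iff :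
    (IsSympUnitary !![a, b; c, d] ∧ IsReflectionSelfAdjoint !![a, b; c, d]) ↔
      a.im = 0 ∧ b.im = 0 ∧ c.im = 0 ∧ d.im = 0 ∧ a = d ∧ a ^ 2 - b * c = 1 := by
  rw [isReflectionSelfAdjoint_fin_two_iff, IsSympUnitary, sympAdjoint_fin_two,
    Matrix.mul_fin_two, Matrix.one_fin_two, fin_two_eq_iff]
  constructor
  · rintro ⟨⟨hdiag, hoff, -, -⟩, hb, hc, rfl⟩
    rw [Complex.conj_conj, Complex.conj_eq_iff_im.2 hb] at hdiag hoff
    have ha : conj a = a := by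
      by_contra hne
      have hb₀ : b = 0 := by
        refine (mul_eq_zero.1 ?_).resolve_left (sub_ne_zero.2 hne)
        linear_combination -hoff
      have hsq : a ^ 2 = 1 := by
        rw [hb₀] at hdiag
        linear_combination hdiag
      rcases sq_eq_one_iff.1 hsq with rfl | rfl <;> simp at hne
    have ha' := Complex.conj_eq_iff_im.1 ha
    exact ⟨ha', hb, hc, by rw [ha, ha'], ha.symm, by linear_combination hdiag⟩
  · rintro ⟨ha, hb, hc, -, rfl, h⟩
    rw [Complex.conj_eq_iff_im.2 ha, Complex.conj_eq_iff_im.2 hb, Complex.conj_eq_iff_im.2 hc]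
    exact ⟨⟨by linear_combination h, by ring, by ring, by linear_combination h⟩, hb, hc, rfl⟩

theorem isReflectionConjInvolutive_of_im_eq_zero (ha : a.im = 0) (hb : b.im = 0)
    (hc : c.im = 0) (h : a ^ 2 - b * c = 1) : IsReflectionConjInvolutive !![a, b; c, a] := by
  rw [isReflectionConjInvolutive_fin_two_iff, Complex.conj_eq_iff_im.2 ha,
    Complex.conj_eq_iff_im.2 hb, Complex.conj_eq_iff_im.2 hc]
  exact ⟨by linear_combination h, by ring, by ring, by linear_combination h⟩

theorem isReflectionSelfAdjoint_and_isReflectionConjInvolutive_iff :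
    (IsReflectionSelfAdjoint !![a, b; c, d] ∧ IsReflectionConjInvolutive !![a, b; c, d]) ↔
      b.im = 0 ∧ c.im = 0 ∧ d = conj a ∧ (‖a‖ : ℂ) ^ 2 - b * c = 1 := by
  rw [isReflectionSelfAdjoint_fin_two_iff, isReflectionConjInvolutive_fin_two_iff,
    ← Complex.conj_mul', and_assoc, and_assoc]
  refine and_congr_right fun hb => and_congr_right fun hc => and_congr_right ?_
  rintro rfl
  rw [Complex.conj_conj, Complex.conj_eq_iff_im.2 hb, Complex.conj_eq_iff_im.2 hc]
  refine and_iff_left_of_imp fun h => ⟨mul_comm _ _, mul_comm _ _, ?_⟩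
  linear_combination h

theorem isSympUnitary_fin_two_iff :
    IsSympUnitary !![a, b; c, d] ↔ conj (a * d - b * c) * (a * d - b * c) = 1 ∧
      a = (a * d - b * c) * conj a ∧ b = (a * d - b * c) * conj b ∧
        c = (a * d - b * c) * conj c ∧ d = (a * d - b * c) * conj d := by
  rw [isSympUnitary_iff, map_conj_fin_two, Matrix.det_fin_two_of]
  simp only [Matrix.smul_of, Matrix.smul_cons, Matrix.smul_empty, smul_eq_mul, fin_two_eq_iff]

theorem isReflectionConjInvolutive_iff_of_isSympUnitary (h : IsSympUnitary !![a, b; c, d]) :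
    IsReflectionConjInvolutive !![a, b; c, d] ↔ a = d := by
  obtain ⟨hu, ha, hb, hc, hd⟩ := isSympUnitary_fin_two_iff.1 h
  rw [isReflectionConjInvolutive_fin_two_iff]
  constructor
  · rintro ⟨h₁₁, -, -, h₂₂⟩
    have hsq : (a - d) ^ 2 = 0 := by
      linear_combination (a * d - b * c) * (h₁₁ + h₂₂) + a * ha - c * hb + d * hd - b * hc
    exact sub_eq_zero.1 (pow_eq_zero_iff two_ne_zero |>.1 hsq)
  · rintro rfl
    have hu₀ : a * a - b * c ≠ 0 := right_ne_zero_of_mul_eq_one hu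
    refine ⟨?_, ?_, ?_, ?_⟩ <;> refine mul_left_cancel₀ hu₀ ?_
    · linear_combination -a * ha + c * hb
    · linear_combination -b * ha + a * hb
    · linear_combination -c * ha + a * hc
    · linear_combination -a * ha + b * hc

theorem conj_mul_self_eq_one_iff {u : ℂ} :
    conj u * u = 1 ↔ ∃ φ : ℝ, Complex.exp (2 * Complex.I * φ) = u := by
  have hnorm : conj u * u = 1 ↔ ‖u‖ = 1 := by
    rw [Complex.conj_mul', ← pow_eq_one_iff_of_nonneg (norm_nonneg u) two_ne_zero]
    norm_cast
  rw [hnorm, Complex.norm_eq_one_iff]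
  refine (Equiv.mulLeft₀ (2 : ℝ) two_ne_zero).surjective.exists.trans (exists_congr fun φ => ?_)
  change Complex.exp (((2 * φ : ℝ) : ℂ) * Complex.I) = u ↔ _
  rw [Complex.ofReal_mul, Complex.ofReal_ofNat, mul_right_comm]

theorem exp_mul_im_eq_zero_iff (φ : ℝ) (z : ℂ) :
    (Complex.exp (-(Complex.I * φ)) * z).im = 0 ↔
      z = Complex.exp (2 * Complex.I * φ) * conj z := by
  have hconj : conj (Complex.exp (-(Complex.I * φ))) = Complex.exp (Complex.I * φ) := by
    rw [← Complex.exp_conj, map_neg, map_mul, Complex.conj_I, Complex.conj_ofReal, neg_mul,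
      neg_neg]
  have hinv : Complex.exp (-(Complex.I * φ)) * Complex.exp (Complex.I * φ) = 1 := by
    rw [← Complex.exp_add, neg_add_cancel, Complex.exp_zero]
  have hsq : Complex.exp (2 * Complex.I * φ) =
      Complex.exp (Complex.I * φ) * Complex.exp (Complex.I * φ) := by
    rw [← Complex.exp_add]
    ring_nf
  rw [← Complex.conj_eq_iff_im, map_mul, hconj, hsq]
  constructor <;> intro h
  · linear_combination -Complex.exp (Complex.I * φ) * h - z * hinv
  · linear_combination -Complex.exp (-(Complex.I * φ)) * h -
      conj z * Complex.exp (Complex.I * φ) * hinv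

theorem isSympUnitary_and_isReflectionConjInvolutive_iff :
    (IsSympUnitary !![a, b; c, d] ∧ IsReflectionConjInvolutive !![a, b; c, d]) ↔
      ∃ φ : ℝ,
        (Complex.exp (-(Complex.I * φ)) * a).im = 0 ∧
        (Complex.exp (-(Complex.I * φ)) * b).im = 0 ∧
        (Complex.exp (-(Complex.I * φ)) * c).im = 0 ∧
        (Complex.exp (-(Complex.I * φ)) * d).im = 0 ∧
        d = Complex.exp (2 * Complex.I * φ) * conj a ∧
        a * d - b * c = Complex.exp (2 * Complex.I * φ) := by
  rw [and_congr_right isReflectionConjInvolutive_iff_of_isSympUnitary, isSympUnitary_fin_two_iff]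
  simp only [exp_mul_im_eq_zero_iff]
  constructor
  · rintro ⟨⟨hu, ha, hb, hc, hd⟩, had⟩
    obtain ⟨φ, hφ⟩ := conj_mul_self_eq_one_iff.1 hu
    rw [← hφ] at ha hb hc hd
    exact ⟨φ, ha, hb, hc, hd, had.symm.trans ha, hφ.symm⟩
  · rintro ⟨φ, ha, hb, hc, hd, hda, hdet⟩
    rw [hdet]
    exact ⟨⟨conj_mul_self_eq_one_iff.2 ⟨φ, rfl⟩, ha, hb, hc, hd⟩, ha.trans hda.symm⟩

end Coefficients

end PTQM

end

theorem mainTheorem5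
    (q : ℝ → ℝ) (hq : LocallyIntegrable q volume) (hq_even : ∀ x, q (-x) = q x)
    (hq_top : PTQM.LimitCircleAtTop q) (hq_bot : PTQM.LimitCircleAtBot q)
    (w₁ w₂ : ℝ → ℂ) (hw : PTQM.IsBoundarySystem q w₁ w₂)
    (a b c d : ℂ) (A : PTQM.L2R →ₗ.[ℂ] PTQM.L2R)
    (hA : A = PTQM.mixedOp₁ q w₁ w₂ !![a, b; c, d] ∨
      A = PTQM.mixedOp₂ q w₁ w₂ !![a, b; c, d]) :
    ((PTQM.IsPTSymmetric A ∧ IsSelfAdjoint A ∧ PTQM.IsPSelfAdjoint A) ↔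
      (a.im = 0 ∧ b.im = 0 ∧ c.im = 0 ∧ d.im = 0 ∧ a = d ∧ a ^ 2 - b * c = 1)) ∧
    ((IsSelfAdjoint A ∧ PTQM.IsPSelfAdjoint A) ↔
      (a.im = 0 ∧ b.im = 0 ∧ c.im = 0 ∧ d.im = 0 ∧ a = d ∧ a ^ 2 - b * c = 1)) ∧
    ((IsSelfAdjoint A ∧ PTQM.IsPSelfAdjoint A) → PTQM.IsPTSymmetric A) ∧
    ((IsSelfAdjoint A ∧ PTQM.IsPTSymmetric A) ↔
      ∃ φ : ℝ,
        (Complex.exp (-(Complex.I * φ)) * a).im = 0 ∧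
        (Complex.exp (-(Complex.I * φ)) * b).im = 0 ∧
        (Complex.exp (-(Complex.I * φ)) * c).im = 0 ∧
        (Complex.exp (-(Complex.I * φ)) * d).im = 0 ∧
        d = Complex.exp (2 * Complex.I * φ) * conj a ∧
        a * d - b * c = Complex.exp (2 * Complex.I * φ)) ∧
    ((PTQM.IsPSelfAdjoint A ∧ PTQM.IsPTSymmetric A) ↔
      (b.im = 0 ∧ c.im = 0 ∧ d = conj a ∧ (‖a‖ : ℂ) ^ 2 - b * c = 1)) := by
  have hpair := hw.isFundamentalPair hq_top hq_bot
  have hPT_of_real : a.im = 0 ∧ b.im = 0 ∧ c.im = 0 ∧ d.im = 0 ∧ a = d ∧ a ^ 2 - b * c = 1 →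
      PTQM.IsReflectionConjInvolutive !![a, b; c, d] := by
    rintro ⟨ha, hb, hc, -, rfl, h⟩
    exact PTQM.isReflectionConjInvolutive_of_im_eq_zero ha hb hc h
  rw [hpair.isSelfAdjoint_iff_isSympUnitary hA,
    hpair.isPSelfAdjoint_iff_isReflectionSelfAdjoint hq_even hw.odd₁ hw.even₂ hA,
    hpair.isPTSymmetric_iff_isReflectionConjInvolutive hq_even hw.odd₁ hw.even₂ hA,
    PTQM.isSympUnitary_and_isReflectionSelfAdjoint_iff]
  exact ⟨and_iff_right_of_imp hPT_of_real, Iff.rfl, hPT_of_real,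
    PTQM.isSympUnitary_and_isReflectionConjInvolutive_iff,
    PTQM.isReflectionSelfAdjoint_and_isReflectionConjInvolutive_iff⟩
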